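/- All bigraphs are bipartite simple graphs $B=(X,Y,E)$ with a fixed bipartition. A \emph{unit interval} is one of $[a,a+1]$, $(a,a+1)$, $[a,a+1)$, $(a,a+1]$ with $a\in\mathbb{R}$. A \emph{mixed unit interval representation} of $B$ is a map $I$ from $X\cup Y$ to the unit intervals such that two distinct vertices $p,q$ are adjacent if and only if $I(p)\cap I(q)\neq\emptyset$ and $p,q$ lie in different partite sets; $B$ is a \emph{mixed unit interval bigraph} if it has such a representation. \emph{Trivial modifications} of a mixed unit interval representation $I$ of $B$ are the following operations: translating all intervals by the same amount; reflecting all intervals about the same point of the real line; relabeling the intervals, that is, replacing $I$ by $I\circ\varphi$ for an automorphism $\varphi$ of $B$; changing the types (closed, open, half-open) of some intervals, with all end points kept, so that the result is again a representation of $B$; shifting some intervals, that is, replacing $I(p)$ by $I(p)+d(p)$ for all vertices $p$, with real numbers $d(p)$ such that $p\mapsto I(p)+t\,d(p)$ is a representation of $B$ for every $t\in[0,1]$. A representation of $B$ is \emph{unique up to trivial modifications} if every mixed unit interval representation of $B$ arises from it by finitely many trivial modifications. For integers $i,j\ge 1$ the bigraph $K'_{i,j}$ has the vertices $$x_0,\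 y_0,\ y,\quad r_0,\dots,r_j,\quad r'_0,\dots,r'_{j-1},\quad l_0,\dots,l_i,\quad l'_0,\dots,l'_{i-1},\quad w,\ z',\ w',\ z'',\ v',\ v''$$ and the edges $x_0y_0$; $y_0r_0,\ y_0l_0,\ yr_0,\ yl_0$; $r_kr_{k+1}$ and $r_kr'_k$ for $0\le k<j$; $l_kl_{k+1}$ and $l_kl'_k$ for $0\le k<i$; $uv',\ uv''$, where $u=r_j$; and $zw,\ wz',\ zw',\ w'z''$, where $z=l_i$. The partite set $X$ is the one that contains $x_0$ (so $r_k$ and $l_k$ are in $X$ for even $k$ and in $Y$ for odd $k$). The bigraph $K_{i,j}$ arises from $K'_{i,j}$ by attaching one new pendant vertex to $v'$ and one to $v''$. \textbf{Lemma 4.} Let $i,j\ge 1$ be integers. (a) The following intervals form a mixed unit interval representation of $K'_{i,j}$, and it is unique up to trivial modifications: \begin{itemize} \item $I(x_0)=(0,1)$, $I(y_0)=\left[-\tfrac12,\tfrac12\right]$, $I(y)=[-1,0]$; \item $I(r_k)=[k,k+1]$ for $0\le k\le j$, and $I(r'_k)=[k+1,k+2)$ for $0\le k<j$; \item $I(l_k)=\left[-k-\tfrac32,-k-\tfrac12\right]$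 for $0\le k\le i$, and $I(l'_k)=\left(-k-\tfrac32,-k-\tfrac12\right]$ for $0\le k<i$; \item each of $I(v')$, $I(v'')$ is $[j+1,j+2]$ or $[j+1,j+2)$ (any choice is allowed); \item $I(w)=\left[-i-\tfrac52,-i-\tfrac32\right]$, $I(z')=\left[-i-\tfrac72,-i-\tfrac52\right]$, $I(w')=I(z'')=\left(-i-\tfrac32,-i-\tfrac12\right)$. \end{itemize} (b) $K_{i,j}$ is a forbidden induced subgraph of mixed unit interval bigraphs: no mixed unit interval bigraph contains an induced subgraph isomorphic to $K_{i,j}$. -/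

import Mathlib

/-- A bigraph: a simple graph with a fixed bipartition of its vertex set into the two partite
sets `X` (`side = false`) and `Y` (`side = true`). -/
structure Bigraph (V : Type*) where
  graph : SimpleGraph V
  side : V → Bool
  side_ne_of_adj : ∀ ⦃u v : V⦄, graph.Adj u v → side u ≠ side v

/-- The family of all unit intervals of the real line: closed, open, closed-open, open-closed. -/
def unitIntervals : Set (Set ℝ) :=
  {S | ∃ a : ℝ, S = Set.Icc a (a + 1) ∨ S = Set.Ioo a (a + 1) ∨
    S = Set.Ico a (a + 1) ∨ S = Set.Ioc a (a + 1)}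

namespace Bigraph

variable {V : Type*}

/-- `f` is an `M`-intersection representation of the bigraph `B`. -/
def IsRep (B : Bigraph V) (M : Set (Set ℝ)) (f : V → Set ℝ) : Prop :=
  (∀ v, f v ∈ M) ∧
    ∀ u v, u ≠ v → (B.graph.Adj u v ↔ (f u ∩ f v).Nonempty ∧ B.side u ≠ B.side v)

/-- `f` is a representation of `B` by unit intervals of all four types. -/
abbrev IsUnitRep (B : Bigraph V) (f : V → Set ℝ) : Prop := B.IsRep unitIntervals f

/-- `B` is a mixed unit interval bigraph. -/
def IsMixedUnitInterval (B : Bigraph V) : Prop := ∃ f : V → Set ℝ, B.IsUnitRep f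

/-- A single trivial modification of a mixed unit interval representation of `B`. -/
inductive TrivialStep (B : Bigraph V) : (V → Set ℝ) → (V → Set ℝ) → Prop
  /-- translation of the entire model -/
  | translate (f : V → Set ℝ) (c : ℝ) :
      TrivialStep B f (fun v => (fun x => x + c) '' f v)
  /-- reflection of the entire model about the point `p` -/
  | reflect (f : V → Set ℝ) (p : ℝ) :
      TrivialStep B f (fun v => (fun x => 2 * p - x) '' f v)
  /-- relabeling of the intervals along an automorphism -/
  | relabel (f : V → Set ℝ) (φ : B.graph ≃g B.graph) :
      TrivialStep B f (fun v => f (φ v))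
  /-- change of the types of some intervals: all end points stay where they are, and the result
  is again a representation -/
  | retype (f g : V → Set ℝ) (hg : B.IsUnitRep g) (h : ∀ v, closure (g v) = closure (f v)) :
      TrivialStep B f g
  /-- shift of some intervals: every interval `f v` slides, keeping its type, by the amount `d v`,
  and all intersections and non-intersections that matter are preserved throughout the motion -/
  | shift (f : V → Set ℝ) (d : V → ℝ)
      (h : ∀ t ∈ Set.Icc (0 : ℝ) 1, B.IsUnitRep (fun v => (fun x => x + t * d v) '' f v)) :
      TrivialStep B f (fun v => (fun x => x + d v) '' f v)

/-- `g` arises from `f` by finitely many trivial modifications. -/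
def TrivialModification (B : Bigraph V) (f g : V → Set ℝ) : Prop :=
  Relation.ReflTransGen B.TrivialStep f g

end Bigraph

/-- The vertices of `K'_{i,j}`.
* `right 0, right 1, right 2, …, right j` are `x₁, y₁, x₂, y₂, …, u`, and `rightPend k` is the
  pendant vertex at `right k` (that is `y₁', x₁', y₂', …`);
* `left 0, left 1, left 2, …, left i` are `x₁'', y₁'', x₂'', y₂'', …, z`, and `leftPend k` is the
  pendant vertex at `left k` (that is `y₁''', x₁''', y₂''', …`);
* `w₁, z₁, w₂, z₂, v₁, v₂` are `w, z', w', z'', v', v''`. -/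
inductive KPrimeVertex (i j : ℕ) : Type
  | x₀ | y₀ | y
  | right (k : Fin (j + 1))
  | rightPend (k : Fin j)
  | left (k : Fin (i + 1))
  | leftPend (k : Fin i)
  | w₁ | z₁ | w₂ | z₂
  | v₁ | v₂

namespace KPrimeVertex

variable {i j : ℕ}

/-- The edges of `K'_{i,j}`, each listed in one direction. -/
def Arc : KPrimeVertex i j → KPrimeVertex i j → Prop
  | x₀, y₀ => True
  | y₀, right k => (k : ℕ) = 0
  | y₀, left k => (k : ℕ) = 0
  | y, right k => (k : ℕ) = 0
  | y, left k => (k : ℕ) = 0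
  | right k, right l => (l : ℕ) = k + 1
  | right k, rightPend l => (l : ℕ) = k
  | right k, v₁ => (k : ℕ) = j
  | right k, v₂ => (k : ℕ) = j
  | left k, left l => (l : ℕ) = k + 1
  | left k, leftPend l => (l : ℕ) = k
  | left k, w₁ => (k : ℕ) = i
  | left k, w₂ => (k : ℕ) = i
  | w₁, z₁ => True
  | w₂, z₂ => True
  | _, _ => False

/-- The partite set of a vertex of `K'_{i,j}`: `false` for `X`, `true` for `Y`. -/
def side : KPrimeVertex i j → Bool
  | x₀ => false
  | y₀ => true
  | y => true
  | right k => (k : ℕ).bodd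
  | rightPend k => !(k : ℕ).bodd
  | left k => (k : ℕ).bodd
  | leftPend k => !(k : ℕ).bodd
  | w₁ => !i.bodd
  | z₁ => i.bodd
  | w₂ => !i.bodd
  | z₂ => i.bodd
  | v₁ => !j.bodd
  | v₂ => !j.bodd

theorem side_ne_of_arc (u v : KPrimeVertex i j) (h : Arc u v) : side u ≠ side v := by
  cases u <;> cases v <;> simp_all [Arc, side]

/-- The explicit intervals. The right chain, its pendant vertices, the left chain and its pendant
vertices are indexed by their position in the chain. The truth values `c₁` and `c₂` choose, for
`v'` and `v''`, between a closed and a closed-open interval. -/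
noncomputable def interval (c₁ c₂ : Bool) : KPrimeVertex i j → Set ℝ
  | x₀ => Set.Ioo 0 1
  | y₀ => Set.Icc (-(1 / 2)) (1 / 2)
  | y => Set.Icc (-1) 0
  | right k => Set.Icc (k : ℝ) ((k : ℝ) + 1)
  | rightPend k => Set.Ico ((k : ℝ) + 1) ((k : ℝ) + 2)
  | left k => Set.Icc (-(k : ℝ) - 3 / 2) (-(k : ℝ) - 1 / 2)
  | leftPend k => Set.Ioc (-(k : ℝ) - 3 / 2) (-(k : ℝ) - 1 / 2)
  | w₁ => Set.Icc (-(i : ℝ) - 5 / 2) (-(i : ℝ) - 3 / 2)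
  | z₁ => Set.Icc (-(i : ℝ) - 7 / 2) (-(i : ℝ) - 5 / 2)
  | w₂ => Set.Ioo (-(i : ℝ) - 3 / 2) (-(i : ℝ) - 1 / 2)
  | z₂ => Set.Ioo (-(i : ℝ) - 3 / 2) (-(i : ℝ) - 1 / 2)
  | v₁ => if c₁ then Set.Icc ((j : ℝ) + 1) ((j : ℝ) + 2) else Set.Ico ((j : ℝ) + 1) ((j : ℝ) + 2)
  | v₂ => if c₂ then Set.Icc ((j : ℝ) + 1) ((j : ℝ) + 2) else Set.Ico ((j : ℝ) + 1) ((j : ℝ) + 2)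

end KPrimeVertex

/-- The bigraph `K'_{i,j}`. -/
def KPrime (i j : ℕ) : Bigraph (KPrimeVertex i j) where
  graph := SimpleGraph.fromRel KPrimeVertex.Arc
  side := KPrimeVertex.side
  side_ne_of_adj := by
    rintro u v ⟨-, h | h⟩
    · exact KPrimeVertex.side_ne_of_arc u v h
    · exact (KPrimeVertex.side_ne_of_arc v u h).symm

/-- The vertices of `K_{i,j}`: those of `K'_{i,j}` and two new pendant vertices `t₁`, `t₂`, attached
to `v'` and `v''` respectively. -/
inductive KVertex (i j : ℕ) : Type
  | base (v : KPrimeVertex i j)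
  | t₁ | t₂

namespace KVertex

variable {i j : ℕ}

/-- The edges of `K_{i,j}`, each listed in one direction. -/
def Arc : KVertex i j → KVertex i j → Prop
  | base u, base v => KPrimeVertex.Arc u v
  | base .v₁, t₁ => True
  | base .v₂, t₂ => True
  | _, _ => False

/-- The partite set of a vertex of `K_{i,j}`. -/
def side : KVertex i j → Bool
  | base v => v.side
  | t₁ => j.bodd
  | t₂ => j.bodd

theorem side_ne_of_arc (u v : KVertex i j) (h : Arc u v) : side u ≠ side v := by
  rcases u with u | _ | _ <;> rcases v with v | _ | _
  · exact KPrimeVertex.side_ne_of_arc u v h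
  · cases u <;> simp_all [Arc, side, KPrimeVertex.side]
  · cases u <;> simp_all [Arc, side, KPrimeVertex.side]
  all_goals exact absurd h (by simp [Arc])

end KVertex

/-- The bigraph `K_{i,j}`. -/
def KBigraph (i j : ℕ) : Bigraph (KVertex i j) where
  graph := SimpleGraph.fromRel KVertex.Arc
  side := KVertex.side
  side_ne_of_adj := by
    rintro u v ⟨-, h | h⟩
    · exact KVertex.side_ne_of_arc u v h
    · exact (KVertex.side_ne_of_arc v u h).symm

/-! A family of unit intervals amounts to left end points and end point types, and two intervals are
disjoint exactly when one lies wholly to the left of the other (`UnitModel.Prec`). Uniqueness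
reduces to this order: if two representations order the non-adjacent pairs from different partite
sets alike, convex combinations of their end points still represent the bigraph. Both can therefore
be shifted to the midpoint, where a change of types joins them (`trivialModification_of_prec_iff`).

It remains to see that the order in K' is forced up to symmetry. After a reflection l₀ begins before
r₀. Around the cycle y₀ r₀ y l₀, the interval of x₀ is enclosed by the two arms and y lies on one
side of it. The arm on the other side is then rigid: its first spine vertex and first pendant vertex
lie exactly one unit beyond its root (`Cycle.rigid_or_rigid`). Rigidity travels along the arm, since
two intervals in the same place that both meet the previous spine interval can only be told apart at
their far ends (`Arm.ends`). For the same reason the last two vertices of a rigid arm cannot both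
have private neighbours (`Arm.not_private`).

On the left, z' and z'' are private neighbours of w and w', so the right arm is the rigid one and
its positions are fixed. The order on the left arm follows by carrying known comparisons along edges
(`Prec.move`), with one extra argument for consecutive pendant vertices. Only the order of w and z''
stays open, and exchanging the two branches at z (`swap`) settles it. In K the vertices v' and v''
have private neighbours as well, so neither arm can be rigid and no representation exists. -/

/-! ### Unit intervals as end point data -/

/-- The data of a family of unit intervals: left end points, and which of the two end points belong
to each interval. -/
structure UnitModel (V : Type*) where
  a : V → ℝ
  lc : V → Prop
  rc : V → Prop

namespace UnitModel

variable {V : Type*}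

/-- The intervals of a model. -/
def toFun (M : UnitModel V) (v : V) : Set ℝ :=
  {x | (M.a v < x ∨ (M.lc v ∧ x = M.a v)) ∧ (x < M.a v + 1 ∨ (M.rc v ∧ x = M.a v + 1))}

/-- The interval of `u` lies entirely to the left of the interval of `v`. -/
def Prec (M : UnitModel V) (u v : V) : Prop :=
  M.a u + 1 < M.a v ∨ (M.a u + 1 = M.a v ∧ ¬ (M.rc u ∧ M.lc v))

/-- The intervals of `u` and `v` intersect. -/
def Touch (M : UnitModel V) (u v : V) : Prop := ¬ M.Prec u v ∧ ¬ M.Prec v u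

/-- `M` is a representation of `B`. -/
def Represents (M : UnitModel V) (B : Bigraph V) : Prop :=
  ∀ u v, B.side u ≠ B.side v → (B.graph.Adj u v ↔ M.Touch u v)

theorem Touch.symm {M : UnitModel V} {u v : V} (h : M.Touch u v) : M.Touch v u := ⟨h.2, h.1⟩

/-- A weak inequality plus a clause for equality is the form used by the later arguments: `linarith`
pins down positions, and the clause then yields the types. -/
theorem prec_iff {M : UnitModel V} {u v : V} :
    M.Prec u v ↔ M.a u + 1 ≤ M.a v ∧ (M.a v = M.a u + 1 → ¬ (M.rc u ∧ M.lc v)) := by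
  constructor
  · rintro (h | ⟨h, h'⟩)
    · exact ⟨h.le, fun e => absurd e h.ne'⟩
    · exact ⟨h.le, fun _ => h'⟩
  · rintro ⟨h, h'⟩
    exact h.lt_or_eq.imp id fun e => ⟨e, h' e.symm⟩

theorem not_prec_iff {M : UnitModel V} {u v : V} :
    ¬ M.Prec u v ↔ M.a v ≤ M.a u + 1 ∧ (M.a v = M.a u + 1 → M.rc u ∧ M.lc v) := by
  rw [prec_iff, not_and_or, not_le, Classical.not_imp, not_not]
  constructor
  · rintro (h | ⟨h, h'⟩)
    · exact ⟨h.le, fun e => absurd e h.ne⟩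
    · exact ⟨h.le, fun _ => h'⟩
  · rintro ⟨h, h'⟩
    exact h.lt_or_eq.imp id fun e => ⟨e, h' e⟩

theorem Prec.le {M : UnitModel V} {u v : V} (h : M.Prec u v) :
    M.a u + 1 ≤ M.a v ∧ (M.a v = M.a u + 1 → ¬ (M.rc u ∧ M.lc v)) := prec_iff.1 h

theorem Touch.le {M : UnitModel V} {u v : V} (h : M.Touch u v) :
    M.a v ≤ M.a u + 1 ∧ (M.a v = M.a u + 1 → M.rc u ∧ M.lc v) := not_prec_iff.1 h.1

theorem Prec.not_prec {M : UnitModel V} {u v : V} (h : M.Prec u v) : ¬ M.Prec v u := by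
  intro h'
  linarith [h.le.1, h'.le.1]

theorem nonempty_inter_iff (M : UnitModel V) (u v : V) :
    (M.toFun u ∩ M.toFun v).Nonempty ↔ M.Touch u v := by
  constructor
  · rintro ⟨x, ⟨h1, h2⟩, h3, h4⟩
    refine ⟨?_, ?_⟩
    · rintro (h | ⟨h, h'⟩)
      · rcases h2 with h2 | ⟨-, h2⟩ <;> rcases h3 with h3 | ⟨-, h3⟩ <;> linarith
      · rcases h2 with h2 | ⟨h5, h2⟩ <;> rcases h3 with h3 | ⟨h6, h3⟩
        · linarith
        · linarith
        · linarith
        · exact h' ⟨h5, h6⟩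
    · rintro (h | ⟨h, h'⟩)
      · rcases h4 with h4 | ⟨-, h4⟩ <;> rcases h1 with h1 | ⟨-, h1⟩ <;> linarith
      · rcases h4 with h4 | ⟨h5, h4⟩ <;> rcases h1 with h1 | ⟨h6, h1⟩
        · linarith
        · linarith
        · linarith
        · exact h' ⟨h5, h6⟩
  · rintro ⟨h1, h2⟩
    rw [not_prec_iff] at h1 h2
    rcases h1.1.lt_or_eq with h3 | h3
    · rcases h2.1.lt_or_eq with h4 | h4
      -- The midpoint of the overlap, interior to both intervals.
      · refine ⟨(M.a u + M.a v + 1) / 2, ⟨Or.inl ?_, Or.inl ?_⟩, Or.inl ?_, Or.inl ?_⟩ <;> linarith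
      · obtain ⟨h5, h6⟩ := h2.2 h4
        exact ⟨M.a u, ⟨Or.inr ⟨h6, rfl⟩, Or.inl (by linarith)⟩, Or.inl (by linarith),
          Or.inr ⟨h5, h4⟩⟩
    · obtain ⟨h5, h6⟩ := h1.2 h3
      exact ⟨M.a v, ⟨Or.inl (by linarith), Or.inr ⟨h5, h3⟩⟩, Or.inr ⟨h6, rfl⟩,
        Or.inl (by linarith)⟩

theorem toFun_eq_of {M : UnitModel V} {v : V} (S : Set ℝ)
    (h : S = Set.Icc (M.a v) (M.a v + 1) ∧ M.lc v ∧ M.rc v ∨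
      S = Set.Ioo (M.a v) (M.a v + 1) ∧ ¬ M.lc v ∧ ¬ M.rc v ∨
      S = Set.Ico (M.a v) (M.a v + 1) ∧ M.lc v ∧ ¬ M.rc v ∨
      S = Set.Ioc (M.a v) (M.a v + 1) ∧ ¬ M.lc v ∧ M.rc v) : M.toFun v = S := by
  ext x
  rcases h with ⟨rfl, h1, h2⟩ | ⟨rfl, h1, h2⟩ | ⟨rfl, h1, h2⟩ | ⟨rfl, h1, h2⟩ <;>
    simp [toFun, h1, h2, le_iff_lt_or_eq, eq_comm]

theorem toFun_mem (M : UnitModel V) (v : V) : M.toFun v ∈ unitIntervals := by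
  refine ⟨M.a v, ?_⟩
  by_cases h1 : M.lc v <;> by_cases h2 : M.rc v
  · exact Or.inl (toFun_eq_of _ (by tauto))
  · exact Or.inr (Or.inr (Or.inl (toFun_eq_of _ (by tauto))))
  · exact Or.inr (Or.inr (Or.inr (toFun_eq_of _ (by tauto))))
  · exact Or.inr (Or.inl (toFun_eq_of _ (by tauto)))

theorem isUnitRep_iff {B : Bigraph V} {M : UnitModel V} :
    B.IsUnitRep M.toFun ↔ M.Represents B := by
  constructor
  · intro h u v huv
    rw [h.2 u v (fun e => huv (e ▸ rfl)), nonempty_inter_iff]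
    tauto
  · intro h
    refine ⟨M.toFun_mem, fun u v _ => ?_⟩
    rw [nonempty_inter_iff]
    by_cases hs : B.side u = B.side v
    · exact ⟨fun h' => absurd hs (B.side_ne_of_adj h'), fun h' => absurd hs h'.2⟩
    · rw [h u v hs]
      tauto

theorem exists_model (f : V → Set ℝ) (hf : ∀ v, f v ∈ unitIntervals) :
    ∃ M : UnitModel V, f = M.toFun := by
  choose a ha using hf
  classical
  refine ⟨⟨a, fun v => a v ∈ f v, fun v => a v + 1 ∈ f v⟩, funext fun v => (toFun_eq_of _ ?_).symm⟩
  rcases ha v with h | h | h | h <;> simp only [h] <;> simp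

/-! ### Reflecting and shifting models -/

/-- The mirror image of a model. -/
def reflect (M : UnitModel V) : UnitModel V := ⟨fun v => -M.a v - 1, M.rc, M.lc⟩

theorem reflect_prec (M : UnitModel V) (u v : V) : M.reflect.Prec u v ↔ M.Prec v u := by
  simp only [Prec, reflect]
  have h1 : -M.a u - 1 + 1 < -M.a v - 1 ↔ M.a v + 1 < M.a u := by
    constructor <;> intro <;> linarith
  have h2 : -M.a u - 1 + 1 = -M.a v - 1 ↔ M.a v + 1 = M.a u := by
    constructor <;> intro <;> linarith
  rw [h1, h2]
  tauto

theorem reflect_touch (M : UnitModel V) (u v : V) : M.reflect.Touch u v ↔ M.Touch u v := by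
  simp only [Touch, reflect_prec]
  tauto

theorem Represents.reflect {M : UnitModel V} {B : Bigraph V} (h : M.Represents B) :
    M.reflect.Represents B := fun u v huv => by rw [h u v huv, reflect_touch]

theorem reflect_reflect (M : UnitModel V) : M.reflect.reflect = M := by
  cases M
  simp [UnitModel.reflect]

theorem reflect_toFun (M : UnitModel V) (v : V) :
    M.reflect.toFun v = (fun x => 2 * 0 - x) '' M.toFun v := by
  ext x
  simp only [toFun, reflect, Set.mem_image, Set.mem_ofPred_eq]
  constructor
  · rintro ⟨h1, h2⟩
    refine ⟨-x, ⟨?_, ?_⟩, by ring⟩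
    · rcases h2 with h2 | ⟨h2, h3⟩
      · exact Or.inl (by linarith)
      · exact Or.inr ⟨h2, by linarith⟩
    · rcases h1 with h2 | ⟨h2, h3⟩
      · exact Or.inl (by linarith)
      · exact Or.inr ⟨h2, by linarith⟩
  · rintro ⟨z, ⟨h1, h2⟩, rfl⟩
    refine ⟨?_, ?_⟩
    · rcases h2 with h2 | ⟨h2, h3⟩
      · exact Or.inl (by linarith)
      · exact Or.inr ⟨h2, by linarith⟩
    · rcases h1 with h2 | ⟨h2, h3⟩
      · exact Or.inl (by linarith)
      · exact Or.inr ⟨h2, by linarith⟩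

/-- The model `M` with each interval `v` moved to the left end point `b v`. -/
def withEnds (M : UnitModel V) (b : V → ℝ) : UnitModel V := ⟨b, M.lc, M.rc⟩

theorem withEnds_toFun (M : UnitModel V) (b d : V → ℝ) (h : ∀ v, b v = M.a v + d v) (v : V) :
    (M.withEnds b).toFun v = (fun x => x + d v) '' M.toFun v := by
  ext x
  simp only [toFun, withEnds, Set.mem_image, Set.mem_ofPred_eq, h]
  constructor
  · rintro ⟨h1, h2⟩
    refine ⟨x - d v, ⟨?_, ?_⟩, by ring⟩
    · rcases h1 with h2 | ⟨h2, h3⟩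
      · exact Or.inl (by linarith)
      · exact Or.inr ⟨h2, by linarith⟩
    · rcases h2 with h2 | ⟨h2, h3⟩
      · exact Or.inl (by linarith)
      · exact Or.inr ⟨h2, by linarith⟩
  · rintro ⟨z, ⟨h1, h2⟩, rfl⟩
    refine ⟨?_, ?_⟩
    · rcases h1 with h2 | ⟨h2, h3⟩
      · exact Or.inl (by linarith)
      · exact Or.inr ⟨h2, by linarith⟩
    · rcases h2 with h2 | ⟨h2, h3⟩
      · exact Or.inl (by linarith)
      · exact Or.inr ⟨h2, by linarith⟩

theorem closure_toFun (M : UnitModel V) (v : V) :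
    closure (M.toFun v) = Set.Icc (M.a v) (M.a v + 1) := by
  apply subset_antisymm
  · refine closure_minimal ?_ isClosed_Icc
    rintro x ⟨h1, h2⟩
    constructor
    · rcases h1 with h | ⟨-, h⟩ <;> linarith
    · rcases h2 with h | ⟨-, h⟩ <;> linarith
  · rw [← closure_Ioo (by linarith : M.a v ≠ M.a v + 1)]
    exact closure_mono fun x hx => ⟨Or.inl hx.1, Or.inl hx.2⟩

/-- The weak inequalities of both models survive averaging. Since `M` has positive weight, equality
in the average forces equality in `M`, where the types of `M` decide correctly. For `s = 1` this
would fail, as the types of `M` need not suit the ends of `N`. -/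
theorem prec_withEnds_iff {M N : UnitModel V} {u v : V} (h : M.Prec u v ↔ N.Prec u v)
    (b : V → ℝ) (s : ℝ) (hs0 : 0 ≤ s) (hs1 : s < 1)
    (hb : ∀ v, b v = (1 - s) * M.a v + s * N.a v) :
    (M.withEnds b).Prec u v ↔ M.Prec u v := by
  have hs2 : 0 < 1 - s := by linarith
  have e : (M.withEnds b).Prec u v ↔ (1 - s) * M.a u + s * N.a u + 1 < (1 - s) * M.a v + s * N.a v ∨
      ((1 - s) * M.a u + s * N.a u + 1 = (1 - s) * M.a v + s * N.a v ∧ ¬ (M.rc u ∧ M.lc v)) := by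
    simp only [Prec, withEnds, hb]
  rw [e]
  constructor
  · intro hP
    by_contra hM
    have hN := mt h.2 hM
    rw [not_prec_iff] at hM hN
    have e1 := mul_le_mul_of_nonneg_left hM.1 hs2.le
    have e2 := mul_le_mul_of_nonneg_left hN.1 hs0
    rcases hP with hP | ⟨hP, hP'⟩
    · nlinarith
    · refine hP' (hM.2 (le_antisymm hM.1 ?_))
      by_contra hlt
      have e3 := mul_lt_mul_of_pos_left (not_le.1 hlt) hs2
      nlinarith
  · intro hM
    have hN := h.1 hM
    have m1 : M.a u + 1 ≤ M.a v := hM.le.1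
    have n1 : N.a u + 1 ≤ N.a v := hN.le.1
    have e1 := mul_le_mul_of_nonneg_left m1 hs2.le
    have e2 := mul_le_mul_of_nonneg_left n1 hs0
    rcases hM with hM | ⟨hM, hM'⟩
    · left
      have e3 := mul_lt_mul_of_pos_left hM hs2
      nlinarith
    · by_cases hlt : (1 - s) * M.a u + s * N.a u + 1 < (1 - s) * M.a v + s * N.a v
      · exact Or.inl hlt
      · exact Or.inr ⟨by nlinarith, hM'⟩

theorem represents_withEnds {B : Bigraph V} {M N : UnitModel V} (hM : M.Represents B)
    (h : ∀ u v, B.side u ≠ B.side v → (M.Prec u v ↔ N.Prec u v))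
    (b : V → ℝ) (s : ℝ) (hs0 : 0 ≤ s) (hs1 : s < 1)
    (hb : ∀ v, b v = (1 - s) * M.a v + s * N.a v) : (M.withEnds b).Represents B := by
  intro u v huv
  rw [hM u v huv, Touch, Touch, prec_withEnds_iff (h u v huv) b s hs0 hs1 hb,
    prec_withEnds_iff (h v u huv.symm) b s hs0 hs1 hb]

/-- Two representations in which the non-adjacent pairs are ordered in the same way arise from each
other by trivial modifications: both are shifted to their midpoint, where only the types differ. -/
theorem trivialModification_of_prec_iff {B : Bigraph V} {M N : UnitModel V} (hM : M.Represents B)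
    (hN : N.Represents B) (h : ∀ u v, B.side u ≠ B.side v → (M.Prec u v ↔ N.Prec u v)) :
    B.TrivialModification M.toFun N.toFun := by
  -- Neither family of types need survive all the way to the other model's end points. At the
  -- midpoint both models have positive weight, so both families are valid there.
  set b : V → ℝ := fun v => (M.a v + N.a v) / 2 with hb
  have e1 : (M.withEnds b).toFun = fun v => (fun x => x + (b v - M.a v)) '' M.toFun v :=
    funext fun v => withEnds_toFun M b (fun v => b v - M.a v) (fun v => by ring) v
  have e2 : N.toFun = fun v => (fun x => x + (N.a v - b v)) '' (N.withEnds b).toFun v :=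
    funext fun v => withEnds_toFun (N.withEnds b) N.a (fun v => N.a v - b v)
      (fun v => by simp [withEnds]) v
  have s1 : B.TrivialStep M.toFun (M.withEnds b).toFun := by
    rw [e1]
    refine .shift _ _ fun t ht => ?_
    have e : (fun v => (fun x => x + t * (b v - M.a v)) '' M.toFun v) =
        (M.withEnds fun v => M.a v + t * (b v - M.a v)).toFun :=
      funext fun v => (withEnds_toFun M _ (fun v => t * (b v - M.a v)) (fun v => rfl) v).symm
    rw [e, isUnitRep_iff]
    exact represents_withEnds hM h _ (t / 2) (by linarith [ht.1]) (by linarith [ht.2])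
      fun v => by simp only [hb]; ring
  have s2 : B.TrivialStep (M.withEnds b).toFun (N.withEnds b).toFun := by
    refine .retype _ _ (isUnitRep_iff.2 ?_) fun v => ?_
    · exact represents_withEnds hN (fun u v huv => (h u v huv).symm) _ (1 / 2) (by norm_num)
        (by norm_num) fun v => by simp only [hb]; ring
    · simp only [closure_toFun, withEnds]
  have s3 : B.TrivialStep (N.withEnds b).toFun N.toFun := by
    conv => arg 3; rw [e2]
    refine .shift _ _ fun t ht => ?_
    have e : (fun v => (fun x => x + t * (N.a v - b v)) '' (N.withEnds b).toFun v) =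
        (N.withEnds fun v => b v + t * (N.a v - b v)).toFun :=
      funext fun v => (withEnds_toFun (N.withEnds b) _ (fun v => t * (N.a v - b v))
        (fun v => rfl) v).symm
    rw [e, isUnitRep_iff]
    exact represents_withEnds hN (fun u v huv => (h u v huv).symm) _ ((1 - t) / 2)
      (by linarith [ht.2]) (by linarith [ht.1]) fun v => by simp only [hb]; ring
  exact ((Relation.ReflTransGen.single s1).tail s2).tail s3

/-- If `p` is left of `r`, then a neighbour of `p` is not right of a neighbour of `r`. -/
theorem Prec.move {M : UnitModel V} {p q r s : V} (h : M.Prec p r) (hpq : M.Touch p q)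
    (hrs : M.Touch r s) (hqs : ¬ M.Touch q s) : M.Prec q s := by
  by_contra hn
  have h' : M.Prec s q := by
    by_contra h2
    exact hqs ⟨hn, h2⟩
  -- A common point of `p`, `q` and one of `r`, `s` are ordered one way by `h` and the opposite way
  -- by `h'`.
  rw [← nonempty_inter_iff] at hpq hrs
  obtain ⟨x, hxp, hxq⟩ := hpq
  obtain ⟨y, hyr, hys⟩ := hrs
  have key : ∀ {u v : V} {x y : ℝ}, M.Prec u v → x ∈ M.toFun u → y ∈ M.toFun v → x < y := by
    rintro u v x y huv ⟨-, h1⟩ ⟨h2, -⟩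
    rcases huv with huv | ⟨huv, hn⟩ <;> rcases h1 with h1 | ⟨h3, h1⟩ <;>
      rcases h2 with h2 | ⟨h4, h2⟩ <;> first | linarith | exact absurd ⟨h3, h4⟩ hn
  exact lt_asymm (key h hxp hyr) (key h' hys hxq)

end UnitModel

/-! ### The cycle and its surroundings -/

namespace UnitModel

variable {V : Type*}

/-- The part of a representation of `K'` around its cycle `y₀ r₀ y l₀`. -/
structure Cycle (M : UnitModel V) (x₀ y₀ y r₀ r₁ r' r₂ l₀ l₁ l' l₂ : V) : Prop where
  xy : M.Touch x₀ y₀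
  yr₀ : M.Touch y₀ r₀
  yl₀ : M.Touch y₀ l₀
  yr : M.Touch y r₀
  yl : M.Touch y l₀
  hr₁ : M.Touch r₀ r₁
  hr' : M.Touch r₀ r'
  hl₁ : M.Touch l₀ l₁
  hl' : M.Touch l₀ l'
  hr₂ : M.Touch r₁ r₂
  hl₂ : M.Touch l₁ l₂
  nxy : ¬ M.Touch x₀ y
  nxr₁ : ¬ M.Touch x₀ r₁
  nxr' : ¬ M.Touch x₀ r'
  nxl₁ : ¬ M.Touch x₀ l₁
  nxl' : ¬ M.Touch x₀ l'
  nrl₁ : ¬ M.Touch r₀ l₁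
  nrl' : ¬ M.Touch r₀ l'
  nlr₁ : ¬ M.Touch l₀ r₁
  nlr' : ¬ M.Touch l₀ r'
  nr₂ : ¬ M.Touch r' r₂
  nl₂ : ¬ M.Touch l' l₂

variable {M : UnitModel V} {x₀ y₀ y r₀ r₁ r' r₂ l₀ l₁ l' l₂ : V}

theorem Cycle.mirror (h : M.Cycle x₀ y₀ y r₀ r₁ r' r₂ l₀ l₁ l' l₂) :
    M.reflect.Cycle x₀ y₀ y l₀ l₁ l' l₂ r₀ r₁ r' r₂ := by
  constructor <;> rw [reflect_touch] <;> cases h <;> assumption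

theorem not_touch {u v : V} (h : ¬ M.Touch u v) : M.Prec u v ∨ M.Prec v u := by
  rwa [Touch, not_and_or, not_not, not_not] at h

/-- Suppose l₀ and r₀ were in the same place. Since r₁ and l₁ tell them apart, these sit exactly one
unit away, on opposite sides, and at each end exactly one of l₀, r₀ is closed. So nothing can meet
both l₀ and r₀ at a mere end point. This puts x₀ between l₁ and r₁, hence in that same place, and
then y, disjoint from x₀, meets l₀ and r₀ only at an end point. -/
theorem Cycle.lt (h : M.Cycle x₀ y₀ y r₀ r₁ r' r₂ l₀ l₁ l' l₂) (hle : M.a l₀ ≤ M.a r₀) :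
    M.a l₀ < M.a r₀ := by
  by_contra hlt
  have e : M.a l₀ = M.a r₀ := by linarith
  obtain ⟨xy, yr₀, yl₀, yr, yl, hr₁, hr', hl₁, hl', hr₂, hl₂, nxy, nxr₁, nxr', nxl₁, nxl', nrl₁,
    nrl', nlr₁, nlr', nr₂, nl₂⟩ := h
  have := xy.le; have := xy.symm.le; have := yr.le; have := yr.symm.le
  have := yl.le; have := yl.symm.le; have := yl₀.le; have := yl₀.symm.le
  have := yr₀.le; have := yr₀.symm.le
  have := hr₁.le; have := hr₁.symm.le; have := hl₁.le; have := hl₁.symm.le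
  rcases not_touch nrl₁ with h1 | h1 <;> rcases not_touch nlr₁ with h2 | h2 <;>
  rcases not_touch nxr₁ with h3 | h3 <;> rcases not_touch nxl₁ with h4 | h4 <;>
  rcases not_touch nxy with h5 | h5 <;>
  have := h1.le <;> have := h2.le <;> have := h3.le <;> have := h4.le <;> have := h5.le <;> grind

/-- Otherwise x₀, l₁, r₀ follow each other from left to right, and y₀, which meets both x₀ and r₀,
leaves no slack: every inequality is an equality. The two possible places of l' relative to x₀ then
both fail. -/
theorem Cycle.prec_x (h : M.Cycle x₀ y₀ y r₀ r₁ r' r₂ l₀ l₁ l' l₂) (hlt : M.a l₀ < M.a r₀) :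
    M.Prec l₁ x₀ := by
  by_contra hn
  obtain ⟨xy, yr₀, yl₀, yr, yl, hr₁, hr', hl₁, hl', hr₂, hl₂, nxy, nxr₁, nxr', nxl₁, nxl', nrl₁,
    nrl', nlr₁, nlr', nr₂, nl₂⟩ := h
  have h1 : M.Prec x₀ l₁ := (not_touch nxl₁).resolve_right hn
  have := h1.le; have := xy.le; have := xy.symm.le
  have := yr₀.le; have := yr₀.symm.le; have := hl₁.le
  have hp : M.Prec l₁ r₀ := by
    refine (not_touch nrl₁).resolve_left fun h => ?_
    have := h.le
    linarith
  have hp' : M.Prec l' r₀ := by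
    refine (not_touch nrl').resolve_left fun h => ?_
    have := h.le; have := hl'.le
    linarith
  have := hp.le; have := hp'.le
  have e1 : M.a l₁ = M.a r₀ - 1 := by linarith
  have e2 : M.a x₀ = M.a r₀ - 2 := by linarith
  have e3 : M.a y₀ = M.a r₀ - 1 := by linarith
  -- If l' is to the right of x₀, then l₁ and l' are the same open interval, contradicting that l₂
  -- meets only l₁. If l' is to the left, then l₀ coincides in position with x₀, and y begins where
  -- both end; being closed there, as is x₀, it would meet x₀.
  rcases not_touch nxl' with h2 | h2
  · have := h2.le
    have e4 : M.a l' = M.a r₀ - 1 := by linarith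
    have := hl₂.le; have := hl₂.symm.le
    rcases not_touch nl₂ with h3 | h3 <;> have := h3.le <;> grind
  · have := h2.le; have := hl'.symm.le; have := yl.le; have := yl.symm.le
    have := yr.le; have := yr.symm.le
    rcases not_touch nxy with h3 | h3 <;> have := h3.le <;> grind

/-- If `x₀` is enclosed between both arms and `y` is on the left of `x₀`, then the arm at `r₀` is
pushed as far to the right as possible. -/
theorem Cycle.rigid (h : M.Cycle x₀ y₀ y r₀ r₁ r' r₂ l₀ l₁ l' l₂) (hlt : M.a l₀ < M.a r₀)
    (hx : M.Prec x₀ r₁) (hy : M.Prec y x₀) :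
    M.a x₀ = M.a r₀ ∧ M.a y + 1 = M.a r₀ ∧ M.a r₁ = M.a r₀ + 1 ∧ M.a r' = M.a r₀ + 1 := by
  obtain ⟨xy, yr₀, yl₀, yr, yl, hr₁, hr', hl₁, hl', hr₂, hl₂, nxy, nxr₁, nxr', nxl₁, nxl', nrl₁,
    nrl', nlr₁, nlr', nr₂, nl₂⟩ := h
  have := hx.le; have := hy.le; have := yr.le; have := hr₁.le; have := hr'.le; have := hr'.symm.le
  -- The cyclic chain r₀ ≤ y + 1 ≤ x₀ ≤ r₁ - 1 ≤ r₀ of left end points collapses.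
  have e1 : M.a x₀ = M.a r₀ := by linarith
  have e2 : M.a y + 1 = M.a r₀ := by linarith
  refine ⟨e1, e2, by linarith, ?_⟩
  have := xy.le; have := xy.symm.le; have := yr₀.le; have := yr₀.symm.le
  have := yl₀.le; have := yl₀.symm.le; have := yl.le; have := yl.symm.le
  -- If r' were left of x₀, it would begin one unit before r₀. Avoiding r' pushes l₀ two units
  -- before r₀, so y₀ ends exactly where x₀ begins. Then x₀ is closed there, as is y, contradicting
  -- their disjointness.
  rcases not_touch nxr' with h1 | h1 <;> rcases not_touch nlr' with h2 | h2 <;>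
    have := h1.le <;> have := h2.le <;> grind

/-- By `Cycle.prec_x` and its mirror image x₀ is enclosed by both arms; the side of x₀ on which y
lies decides which arm is rigid. -/
theorem Cycle.rigid_or_rigid (h : M.Cycle x₀ y₀ y r₀ r₁ r' r₂ l₀ l₁ l' l₂)
    (hlt : M.a l₀ < M.a r₀) :
    (M.a x₀ = M.a r₀ ∧ M.a y + 1 = M.a r₀ ∧ M.a r₁ = M.a r₀ + 1 ∧ M.a r' = M.a r₀ + 1) ∨
    (M.reflect.a l₁ = M.reflect.a l₀ + 1 ∧ M.reflect.a l' = M.reflect.a l₀ + 1) := by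
  have hlt' : M.reflect.a r₀ < M.reflect.a l₀ := by
    simp only [reflect]
    linarith
  have h1 := h.prec_x hlt
  have h2 := h.mirror.prec_x hlt'
  rcases not_touch h.nxy with h3 | h3
  · rw [← reflect_prec] at h1 h3
    exact Or.inr (h.mirror.rigid hlt' h1 h3).2.2
  · rw [reflect_prec] at h2
    exact Or.inl (h.rigid hlt h2 h3)

/-! ### Rigid arms -/

/-- A caterpillar whose spine and whose pendant vertices are forced to one side. -/
structure Arm (M : UnitModel V) (n : ℕ) (c d : ℕ → V) : Prop where
  spine : ∀ k ≤ n, M.Touch (c k) (c (k + 1))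
  pend : ∀ k ≤ n, M.Touch (c k) (d k)
  not_spine : ∀ k < n, ¬ M.Touch (d k) (c (k + 2))
  not_pend : ∀ k < n, ¬ M.Touch (d k) (d (k + 1))

/-- Intervals `p` and `q` in the same place can only be separated at an end point. The left end is
excluded: `q` meets `u` there, so it is closed and misses nothing that `p` meets. -/
theorem eq_of_touch_of_not_touch {u p q t : V} (hp : M.a p = M.a u + 1) (hq : M.a q = M.a u + 1)
    (huq : M.Touch u q) (hpt : M.Touch p t) (hqt : ¬ M.Touch q t) :
    M.a t = M.a p + 1 ∧ ¬ M.rc q ∧ M.rc p := by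
  have := huq.le; have := hpt.le; have := hpt.symm.le
  rcases not_touch hqt with h | h <;> have := h.le <;> grind

theorem Arm.ends {n : ℕ} {c d : ℕ → V} (h : M.Arm n c d) (hc : M.a (c 1) = M.a (c 0) + 1)
    (hd : M.a (d 0) = M.a (c 0) + 1) (k : ℕ) (hk : k ≤ n) :
    M.a (c k) = M.a (c 0) + k ∧ M.a (c (k + 1)) = M.a (c 0) + k + 1 ∧
      M.a (d k) = M.a (c 0) + k + 1 := by
  induction k with
  | zero => simpa using ⟨hc, hd⟩
  | succ k ih =>
    obtain ⟨h1, h2, h3⟩ := ih (by omega)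
    have e1 := (eq_of_touch_of_not_touch (h2.trans (by rw [h1])) (h3.trans (by rw [h1]))
      (h.pend k (by omega)) (h.spine (k + 1) hk) (h.not_spine k (by omega))).1
    have e2 := (eq_of_touch_of_not_touch (h2.trans (by rw [h1])) (h3.trans (by rw [h1]))
      (h.pend k (by omega)) (h.pend (k + 1) hk) (h.not_pend k (by omega))).1
    push_cast
    refine ⟨?_, ?_, ?_⟩ <;> linarith

/-- The last spine vertex and the last pendant vertex share their place, so each private neighbour
requires its owner to be closed on the right and the other to be open. -/
theorem Arm.not_private {n : ℕ} {c d : ℕ → V} (h : M.Arm n c d) {s t : V}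
    (hs : M.Touch (c (n + 1)) s) (ht : M.Touch (d n) t) (ns : ¬ M.Touch (d n) s)
    (nt : ¬ M.Touch (c (n + 1)) t)
    (hcd : M.a (c 1) = M.a (c 0) + 1 ∧ M.a (d 0) = M.a (c 0) + 1) : False := by
  obtain ⟨h1, h2, h3⟩ := h.ends hcd.1 hcd.2 n le_rfl
  rw [← h1] at h2 h3
  exact (eq_of_touch_of_not_touch h2 h3 (h.pend n le_rfl) hs ns).2.1
    (eq_of_touch_of_not_touch h3 h2 (h.spine n le_rfl) ht nt).2.2

end UnitModel

/-! ### Uniform indexing of K' -/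

theorem Nat.bodd_eq_decide (k : ℕ) : k.bodd = decide (k % 2 = 1) := by
  rw [Nat.mod_two_of_bodd]
  cases k.bodd <;> rfl

namespace KPrimeVertex

variable {i j : ℕ}

/-- The right chain, continued by `v'`. -/
def rSpine (k : ℕ) : KPrimeVertex i j := if h : k < j + 1 then right ⟨k, h⟩ else v₁

/-- The pendant vertices of the right chain, continued by `v''`. -/
def rPend (k : ℕ) : KPrimeVertex i j := if h : k < j then rightPend ⟨k, h⟩ else v₂

/-- The left chain, continued by `w` and `z'`. -/
def lSpine (k : ℕ) : KPrimeVertex i j :=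
  if h : k < i + 1 then left ⟨k, h⟩ else if k = i + 1 then w₁ else z₁

/-- The pendant vertices of the left chain, continued by `w'`. -/
def lPend (k : ℕ) : KPrimeVertex i j := if h : k < i then leftPend ⟨k, h⟩ else w₂

/-- The end vertices are absorbed into the chains, so that inductions along an arm reach them too;
z'' alone belongs to no chain. -/
theorem exists_position (u : KPrimeVertex i j) :
    u = x₀ ∨ u = y₀ ∨ u = y ∨ (∃ k ≤ j + 1, u = rSpine k) ∨ (∃ k ≤ j, u = rPend k) ∨
      (∃ k ≤ i + 2, u = lSpine k) ∨ (∃ k ≤ i, u = lPend k) ∨ u = z₂ := by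
  rcases u with _ | _ | _ | ⟨k, hk⟩ | ⟨k, hk⟩ | ⟨k, hk⟩ | ⟨k, hk⟩ | _ | _ | _ | _ | _ | _
  · simp
  · simp
  · simp
  · exact .inr (.inr (.inr (.inl ⟨k, by omega, by simp [rSpine, hk]⟩)))
  · exact .inr (.inr (.inr (.inr (.inl ⟨k, by omega, by simp [rPend, hk]⟩))))
  · exact .inr (.inr (.inr (.inr (.inr (.inl ⟨k, by omega, by simp [lSpine, hk]⟩)))))
  · exact .inr (.inr (.inr (.inr (.inr (.inr (.inl ⟨k, by omega, by simp [lPend, hk]⟩))))))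
  · exact .inr (.inr (.inr (.inr (.inr (.inl ⟨i + 1, by omega, by simp [lSpine]⟩)))))
  · exact .inr (.inr (.inr (.inr (.inr (.inl ⟨i + 2, by omega, by simp [lSpine]⟩)))))
  · exact .inr (.inr (.inr (.inr (.inr (.inr (.inl ⟨i, by omega, by simp [lPend]⟩))))))
  · simp
  · exact .inr (.inr (.inr (.inl ⟨j + 1, by omega, by simp [rSpine]⟩)))
  · exact .inr (.inr (.inr (.inr (.inl ⟨j, by omega, by simp [rPend]⟩))))

theorem side_rSpine {k : ℕ} (hk : k ≤ j + 1) :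
    side (rSpine k : KPrimeVertex i j) = decide (k % 2 = 1) := by
  unfold rSpine
  split_ifs
  · simp [side, Nat.bodd_eq_decide]
  · obtain rfl : k = j + 1 := by omega
    simp only [side, ← Nat.bodd_eq_decide, Nat.bodd_succ]

theorem side_rPend {k : ℕ} (hk : k ≤ j) :
    side (rPend k : KPrimeVertex i j) = !decide (k % 2 = 1) := by
  unfold rPend
  split_ifs
  · simp [side, Nat.bodd_eq_decide]
  · obtain rfl : k = j := by omega
    simp only [side, ← Nat.bodd_eq_decide]

theorem side_lSpine {k : ℕ} (hk : k ≤ i + 2) :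
    side (lSpine k : KPrimeVertex i j) = decide (k % 2 = 1) := by
  unfold lSpine
  split_ifs with h1 h2
  · simp [side, Nat.bodd_eq_decide]
  · subst h2
    simp only [side, ← Nat.bodd_eq_decide, Nat.bodd_succ]
  · obtain rfl : k = i + 2 := by omega
    simp only [side, ← Nat.bodd_eq_decide, Nat.bodd_succ, Bool.not_not]

theorem side_lPend {k : ℕ} (hk : k ≤ i) :
    side (lPend k : KPrimeVertex i j) = !decide (k % 2 = 1) := by
  unfold lPend
  split_ifs
  · simp [side, Nat.bodd_eq_decide]
  · obtain rfl : k = i := by omega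
    simp only [side, ← Nat.bodd_eq_decide]

theorem side_z₂ : side (z₂ : KPrimeVertex i j) = decide (i % 2 = 1) := Nat.bodd_eq_decide i

theorem arc_rSpine {k : ℕ} (hk : k ≤ j) :
    Arc (rSpine k : KPrimeVertex i j) (rSpine (k + 1)) := by
  unfold rSpine
  split_ifs <;> simp only [Arc] <;> omega

theorem arc_rPend {k : ℕ} (hk : k ≤ j) : Arc (rSpine k : KPrimeVertex i j) (rPend k) := by
  unfold rSpine rPend
  split_ifs <;> simp only [Arc] <;> omega

theorem arc_lSpine {k : ℕ} (hk : k ≤ i + 1) :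
    Arc (lSpine k : KPrimeVertex i j) (lSpine (k + 1)) := by
  unfold lSpine
  split_ifs <;> simp only [Arc] <;> omega

theorem arc_lPend {k : ℕ} (hk : k ≤ i) : Arc (lSpine k : KPrimeVertex i j) (lPend k) := by
  unfold lSpine lPend
  split_ifs <;> simp only [Arc] <;> omega

theorem arc_lPend_z₂ : Arc (lPend i : KPrimeVertex i j) z₂ := by
  simp [lPend, Arc]

theorem arc_y₀_rSpine : Arc (y₀ : KPrimeVertex i j) (rSpine 0) := by simp [rSpine, Arc]

theorem arc_y₀_lSpine : Arc (y₀ : KPrimeVertex i j) (lSpine 0) := by simp [lSpine, Arc]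

theorem arc_y_rSpine : Arc (y : KPrimeVertex i j) (rSpine 0) := by simp [rSpine, Arc]

theorem arc_y_lSpine : Arc (y : KPrimeVertex i j) (lSpine 0) := by simp [lSpine, Arc]

/-- `u` and `v` are on different sides and not adjacent. -/
def Apart (u v : KPrimeVertex i j) : Prop := side u ≠ side v ∧ ¬ Arc u v ∧ ¬ Arc v u

theorem apart_rPend_rSpine {k : ℕ} (hk : k < j) :
    Apart (rPend k : KPrimeVertex i j) (rSpine (k + 2)) := by
  refine ⟨?_, ?_, ?_⟩
  · rw [side_rPend (by omega), side_rSpine (by omega), Nat.add_mod_right]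
    simp
  all_goals
    unfold rSpine rPend
    split_ifs <;> simp only [Arc, not_false_eq_true] <;> omega

theorem apart_rPend_rPend {k : ℕ} (hk : k < j) :
    Apart (rPend k : KPrimeVertex i j) (rPend (k + 1)) := by
  refine ⟨?_, ?_, ?_⟩
  · rw [side_rPend (by omega), side_rPend (by omega)]
    simp only [ne_eq, Bool.not_eq_eq_eq_not, Bool.not_not, decide_eq_decide]
    omega
  all_goals
    unfold rPend
    split_ifs <;> simp only [Arc, not_false_eq_true]

theorem apart_lSpine_lSpine {k m : ℕ} (hk : k ≤ i + 2) (hmk : m + 3 ≤ k) (h : k % 2 ≠ m % 2) :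
    Apart (lSpine k : KPrimeVertex i j) (lSpine m) := by
  refine ⟨?_, ?_, ?_⟩
  · rw [side_lSpine hk, side_lSpine (by omega)]
    simp only [ne_eq, decide_eq_decide]
    omega
  all_goals
    unfold lSpine
    split_ifs <;> simp only [Arc, not_false_eq_true] <;> omega

theorem apart_lPend_lSpine {k m : ℕ} (hm : m ≤ i) (hk : k ≤ i + 2) (hmk : m ≠ k)
    (h : k % 2 = m % 2) : Apart (lPend m : KPrimeVertex i j) (lSpine k) := by
  refine ⟨?_, ?_, ?_⟩
  · rw [side_lSpine hk, side_lPend hm, h]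
    simp
  all_goals
    unfold lSpine lPend
    split_ifs <;> simp only [Arc, not_false_eq_true] <;> omega

theorem apart_lPend_lPend {k m : ℕ} (hm : m ≤ i) (hk : k ≤ i) (h : k % 2 ≠ m % 2) :
    Apart (lPend m : KPrimeVertex i j) (lPend k) := by
  refine ⟨?_, ?_, ?_⟩
  · rw [side_lPend hm, side_lPend hk]
    simp only [ne_eq, Bool.not_eq_eq_eq_not, Bool.not_not, decide_eq_decide]
    omega
  all_goals
    unfold lPend
    split_ifs <;> simp only [Arc, not_false_eq_true]

theorem apart_z₂_lSpine {k : ℕ} (hk : k ≤ i + 2) (h : k % 2 ≠ i % 2) :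
    Apart (z₂ : KPrimeVertex i j) (lSpine k) := by
  refine ⟨?_, ?_, ?_⟩
  · rw [side_lSpine hk, side_z₂]
    simp only [ne_eq, decide_eq_decide]
    omega
  all_goals
    unfold lSpine
    split_ifs <;> simp only [Arc, not_false_eq_true]

theorem apart_z₂_lPend {k : ℕ} (hk : k < i) (h : k % 2 = i % 2) :
    Apart (z₂ : KPrimeVertex i j) (lPend k) := by
  refine ⟨?_, ?_, ?_⟩
  · rw [side_lPend hk.le, side_z₂, h]
    simp
  all_goals
    unfold lPend
    split_ifs
    simp only [Arc, not_false_eq_true]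

theorem apart_y_lSpine {k : ℕ} (hk : k ≤ i + 2) (h0 : k ≠ 0) (h : k % 2 = 0) :
    Apart (y : KPrimeVertex i j) (lSpine k) := by
  refine ⟨by rw [side_lSpine hk]; simp [side, h], ?_, ?_⟩ <;>
    unfold lSpine <;> split_ifs <;> simp [Arc, h0]

theorem apart_y_lPend {k : ℕ} (hk : k ≤ i) (h : k % 2 = 1) :
    Apart (y : KPrimeVertex i j) (lPend k) := by
  refine ⟨by rw [side_lPend hk]; simp [side, h], ?_, ?_⟩ <;>
    unfold lPend <;> split_ifs <;> simp [Arc]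

theorem apart_rSpine_lSpine {k : ℕ} (hk : k ≤ i + 2) (h : k % 2 = 1) :
    Apart (rSpine 0 : KPrimeVertex i j) (lSpine k) := by
  refine ⟨by rw [side_lSpine hk, side_rSpine (by omega)]; simp [h], ?_, ?_⟩ <;>
    unfold lSpine rSpine <;> split_ifs <;> simp [Arc]

theorem apart_rSpine_lPend {k : ℕ} (hk : k ≤ i) (h : k % 2 = 0) :
    Apart (rSpine 0 : KPrimeVertex i j) (lPend k) := by
  refine ⟨by rw [side_lPend hk, side_rSpine (by omega)]; simp [h], ?_, ?_⟩ <;>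
    unfold lPend rSpine <;> split_ifs <;> simp [Arc]

end KPrimeVertex

open KPrimeVertex in
theorem KPrime_adj {i j : ℕ} {u v : KPrimeVertex i j} :
    (KPrime i j).graph.Adj u v ↔ Arc u v ∨ Arc v u := by
  refine ⟨fun h => h.2, fun h => ⟨?_, h⟩⟩
  rintro rfl
  rcases h with h | h <;> exact side_ne_of_arc _ _ h rfl

/-! ### Rigidity of the right arm in K' -/

namespace UnitModel.Represents

open KPrimeVertex

variable {i j : ℕ} {M : UnitModel (KPrimeVertex i j)}

theorem touch (h : M.Represents (KPrime i j)) {u v : KPrimeVertex i j} (huv : Arc u v) : M.Touch u v :=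
  (h u v (side_ne_of_arc u v huv)).1 (KPrime_adj.2 (Or.inl huv))

theorem not_touch (h : M.Represents (KPrime i j)) {u v : KPrimeVertex i j} (huv : Apart u v) :
    ¬ M.Touch u v := by
  rw [← h u v huv.1, KPrime_adj]
  exact not_or.2 huv.2

end UnitModel.Represents

namespace UnitModel.Represents

open KPrimeVertex

variable {i j : ℕ} {M : UnitModel (KPrimeVertex i j)}

theorem rArm (h : M.Represents (KPrime i j)) : M.Arm j rSpine rPend where
  spine _ hk := h.touch (arc_rSpine hk)
  pend _ hk := h.touch (arc_rPend hk)
  not_spine _ hk := h.not_touch (apart_rPend_rSpine hk)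
  not_pend _ hk := h.not_touch (apart_rPend_rPend hk)

theorem lArm (h : M.Represents (KPrime i j)) : M.Arm i lSpine lPend where
  spine _ hk := h.touch (arc_lSpine (by omega))
  pend _ hk := h.touch (arc_lPend hk)
  not_spine _ hk := h.not_touch
    (apart_lPend_lSpine hk.le (by omega) (by omega) (by omega))
  not_pend _ hk := h.not_touch (apart_lPend_lPend hk.le (by omega) (by omega))

theorem cycle (h : M.Represents (KPrime i j)) (hi : 1 ≤ i) (hj : 1 ≤ j) :
    M.Cycle x₀ y₀ y (rSpine 0) (rSpine 1) (rPend 0) (rSpine 2)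
      (lSpine 0) (lSpine 1) (lPend 0) (lSpine 2) where
  xy := h.touch trivial
  yr₀ := h.touch arc_y₀_rSpine
  yl₀ := h.touch arc_y₀_lSpine
  yr := h.touch arc_y_rSpine
  yl := h.touch arc_y_lSpine
  hr₁ := h.touch (arc_rSpine (by omega))
  hr' := h.touch (arc_rPend (by omega))
  hl₁ := h.touch (arc_lSpine (by omega))
  hl' := h.touch (arc_lPend (by omega))
  hr₂ := h.touch (arc_rSpine (by omega))
  hl₂ := h.touch (arc_lSpine (by omega))
  nxy := h.not_touch ⟨by simp [side], by simp [Arc], by simp [Arc]⟩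
  nxr₁ := h.not_touch ⟨by rw [side_rSpine (by omega)]; simp [side],
    by unfold rSpine; split_ifs <;> simp [Arc], by unfold rSpine; split_ifs <;> simp [Arc]⟩
  nxr' := h.not_touch ⟨by rw [side_rPend (by omega)]; simp [side],
    by unfold rPend; split_ifs <;> simp [Arc], by unfold rPend; split_ifs <;> simp [Arc]⟩
  nxl₁ := h.not_touch ⟨by rw [side_lSpine (by omega)]; simp [side],
    by unfold lSpine; split_ifs <;> simp [Arc], by unfold lSpine; split_ifs <;> simp [Arc]⟩
  nxl' := h.not_touch ⟨by rw [side_lPend (by omega)]; simp [side],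
    by unfold lPend; split_ifs <;> simp [Arc], by unfold lPend; split_ifs <;> simp [Arc]⟩
  nrl₁ := h.not_touch ⟨by rw [side_lSpine (by omega), side_rSpine (by omega)]; simp,
    by unfold lSpine rSpine; split_ifs <;> simp [Arc],
    by unfold lSpine rSpine; split_ifs <;> simp [Arc]⟩
  nrl' := h.not_touch ⟨by rw [side_lPend (by omega), side_rSpine (by omega)]; simp,
    by unfold lPend rSpine; split_ifs <;> simp [Arc],
    by unfold lPend rSpine; split_ifs <;> simp [Arc]⟩
  nlr₁ := h.not_touch ⟨by rw [side_lSpine (by omega), side_rSpine (by omega)]; simp,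
    by unfold lSpine rSpine; split_ifs <;> simp [Arc],
    by unfold lSpine rSpine; split_ifs <;> simp [Arc]⟩
  nlr' := h.not_touch ⟨by rw [side_rPend (by omega), side_lSpine (by omega)]; simp,
    by unfold rPend lSpine; split_ifs <;> simp [Arc],
    by unfold rPend lSpine; split_ifs <;> simp [Arc]⟩
  nr₂ := h.not_touch (apart_rPend_rSpine (by omega))
  nl₂ := h.not_touch (apart_lPend_lSpine (by omega) (by omega) (by omega) (by omega))

/-- The last two vertices of the left arm, w and w', have the private neighbours z' and z''. -/
theorem not_rigid_left (h : M.Represents (KPrime i j))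
    (hd : M.a (lSpine 1) = M.a (lSpine 0) + 1 ∧ M.a (lPend 0) = M.a (lSpine 0) + 1) : False :=
  h.lArm.not_private (h.touch (arc_lSpine le_rfl)) (h.touch arc_lPend_z₂)
    (h.not_touch (apart_lPend_lSpine le_rfl le_rfl (by omega) (by omega)))
    (fun ht => h.not_touch (apart_z₂_lSpine (by omega) (by omega)) ht.symm) hd

theorem rigid (h : M.Represents (KPrime i j)) (hi : 1 ≤ i) (hj : 1 ≤ j)
    (hle : M.a (lSpine 0) ≤ M.a (rSpine 0)) :
    M.a x₀ = M.a (rSpine 0) ∧ M.a y + 1 = M.a (rSpine 0) ∧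
      M.a (rSpine 1) = M.a (rSpine 0) + 1 ∧ M.a (rPend 0) = M.a (rSpine 0) + 1 :=
  ((h.cycle hi hj).rigid_or_rigid ((h.cycle hi hj).lt hle)).resolve_right
    fun hd => h.reflect.not_rigid_left hd

/-! ### The forced order on the left arm -/

theorem move (h : M.Represents (KPrime i j)) {p q r s : KPrimeVertex i j} (hpr : M.Prec p r)
    (hpq : M.Touch p q) (hrs : M.Touch r s) (hqs : Apart q s) : M.Prec q s :=
  hpr.move hpq hrs (h.not_touch hqs)

theorem move' (h : M.Represents (KPrime i j)) {p q r s : KPrimeVertex i j} (hpr : M.Prec p r)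
    (hpq : M.Touch p q) (hrs : M.Touch r s) (hqs : Apart s q) : M.Prec q s :=
  hpr.move hpq hrs fun ht => h.not_touch hqs ht.symm

/-- The edge between y and r₀ provides the alternation: each step along the spine moves the
comparison across that edge. At the start, l₁ begins at most one unit after l₀, too early to lie
beyond r₀. -/
theorem lSpine_prec (h : M.Represents (KPrime i j))
    (hlt : M.a (lSpine 0) < M.a (rSpine 0)) (k : ℕ) (hk0 : 1 ≤ k) (hk : k ≤ i + 2) :
    (k % 2 = 1 → M.Prec (lSpine k) (rSpine 0)) ∧ (k % 2 = 0 → M.Prec (lSpine k) y) := by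
  induction k, hk0 using Nat.le_induction with
  | base =>
    refine ⟨fun _ => ?_, fun h => by omega⟩
    refine (UnitModel.not_touch (h.not_touch (apart_rSpine_lSpine hk rfl))).resolve_left
      fun hp => ?_
    linarith [hp.le.1, (h.touch (arc_lSpine (show 0 ≤ i + 1 by omega))).le.1]
  | succ k hk0 ih =>
    obtain ⟨h1, h2⟩ := ih (by omega)
    have ht := h.touch (arc_lSpine (show k ≤ i + 1 by omega))
    exact ⟨fun hm => h.move' (h2 (by omega)) ht (h.touch arc_y_rSpine) (apart_rSpine_lSpine hk hm),
      fun hm => h.move' (h1 (by omega)) ht (h.touch arc_y_rSpine).symm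
        (apart_y_lSpine hk (by omega) hm)⟩

theorem lPend_prec (h : M.Represents (KPrime i j))
    (hlt : M.a (lSpine 0) < M.a (rSpine 0)) (k : ℕ) (hk : k ≤ i) :
    (k % 2 = 0 → M.Prec (lPend k) (rSpine 0)) ∧ (k % 2 = 1 → M.Prec (lPend k) y) := by
  have ht := h.touch (arc_lPend hk)
  rcases Nat.eq_zero_or_pos k with rfl | h0
  · refine ⟨fun _ => ?_, fun h => by omega⟩
    refine (UnitModel.not_touch (h.not_touch (apart_rSpine_lPend hk rfl))).resolve_left
      fun hp => ?_
    linarith [hp.le.1, ht.le.1]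
  · obtain ⟨h1, h2⟩ := h.lSpine_prec hlt k h0 (by omega)
    exact ⟨fun hm => h.move' (h2 (by omega)) ht (h.touch arc_y_rSpine) (apart_rSpine_lPend hk hm),
      fun hm => h.move' (h1 (by omega)) ht (h.touch arc_y_rSpine).symm (apart_y_lPend hk hm)⟩

theorem z₂_prec (h : M.Represents (KPrime i j)) (hlt : M.a (lSpine 0) < M.a (rSpine 0)) :
    (i % 2 = 1 → M.Prec z₂ (rSpine 0)) ∧ (i % 2 = 0 → M.Prec z₂ y) := by
  obtain ⟨h1, h2⟩ := h.lPend_prec hlt i le_rfl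
  have ht := h.touch (arc_lPend_z₂ (i := i) (j := j))
  refine ⟨fun hm => h.move (h2 hm) ht (h.touch arc_y_rSpine) ⟨?_, ?_, ?_⟩,
    fun hm => h.move (h1 hm) ht (h.touch arc_y_rSpine).symm ⟨?_, ?_, ?_⟩⟩
  · rw [side_z₂, side_rSpine (by omega)]
    simp [hm]
  · simp [Arc]
  · simp [rSpine, Arc]
  · rw [side_z₂]
    simp [hm, side]
  · simp [Arc]
  · simp [Arc]

/-- Both indices advance together by `move`, starting from the comparison with y, which is a
neighbour of l₀. -/
theorem lSpine_prec_lSpine (h : M.Represents (KPrime i j))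
    (hlt : M.a (lSpine 0) < M.a (rSpine 0)) (m : ℕ) : ∀ k, m + 3 ≤ k → k ≤ i + 2 →
      k % 2 ≠ m % 2 → M.Prec (lSpine k) (lSpine m) := by
  induction m with
  | zero =>
    intro k hmk hk hp
    obtain ⟨k, rfl⟩ : ∃ l, k = l + 1 := ⟨k - 1, by omega⟩
    exact h.move ((h.lSpine_prec hlt k (by omega) (by omega)).2 (by omega))
      (h.touch (arc_lSpine (by omega))) (h.touch arc_y_lSpine) (apart_lSpine_lSpine hk hmk hp)
  | succ m ih =>
    intro k hmk hk hp
    obtain ⟨k, rfl⟩ : ∃ l, k = l + 1 := ⟨k - 1, by omega⟩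
    exact h.move (ih k (by omega) (by omega) (by omega)) (h.touch (arc_lSpine (by omega)))
      (h.touch (arc_lSpine (by omega))) (apart_lSpine_lSpine hk hmk hp)

theorem lPend_prec_lSpine (h : M.Represents (KPrime i j))
    (hlt : M.a (lSpine 0) < M.a (rSpine 0)) {k m : ℕ} (hmk : m + 2 ≤ k) (hk : k ≤ i)
    (hp : k % 2 = m % 2) : M.Prec (lPend k) (lSpine m) := by
  have ha : Apart (lPend k : KPrimeVertex i j) (lSpine m) :=
    apart_lPend_lSpine hk (by omega) (by omega) (by omega)
  rcases m with _ | m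
  · exact h.move ((h.lSpine_prec hlt k (by omega) (by omega)).2 (by omega))
      (h.touch (arc_lPend hk)) (h.touch arc_y_lSpine) ha
  · exact h.move (h.lSpine_prec_lSpine hlt m k (by omega) (by omega) (by omega))
      (h.touch (arc_lPend hk)) (h.touch (arc_lSpine (by omega))) ha

theorem lSpine_prec_lPend (h : M.Represents (KPrime i j))
    (hlt : M.a (lSpine 0) < M.a (rSpine 0)) {k m : ℕ} (hmk : m + 2 ≤ k) (hk : k ≤ i + 2)
    (hm : m < i) (hp : k % 2 = m % 2) : M.Prec (lSpine k) (lPend m) := by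
  have ha : Apart (lPend m : KPrimeVertex i j) (lSpine k) :=
    apart_lPend_lSpine hm.le hk (by omega) hp
  by_cases hk' : k ≤ i + 1
  · exact h.move' (h.lSpine_prec_lSpine hlt m (k + 1) (by omega) (by omega) (by omega))
      (h.touch (arc_lSpine (by omega))).symm (h.touch (arc_lPend hm.le)) ha
  -- The spine ends here, so the comparison comes from the preceding vertex; parity and `m < i`
  -- leave the required distance of three.
  · obtain rfl : k = i + 2 := by omega
    exact h.move' (h.lSpine_prec_lSpine hlt m (i + 1) (by omega) (by omega) (by omega))
      (h.touch (arc_lSpine (by omega))) (h.touch (arc_lPend hm.le)) ha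

theorem lPend_prec_lPend (h : M.Represents (KPrime i j))
    (hlt : M.a (lSpine 0) < M.a (rSpine 0)) {k m : ℕ} (hmk : m < k) (hk : k ≤ i)
    (hp : k % 2 ≠ m % 2) : M.Prec (lPend k) (lPend m) := by
  have ha : Apart (lPend m : KPrimeVertex i j) (lPend k) :=
    apart_lPend_lPend (by omega) hk (by omega)
  by_cases hmk' : m + 3 ≤ k
  · exact h.move' (h.lSpine_prec_lSpine hlt m k hmk' (by omega) hp)
      (h.touch (arc_lPend hk)) (h.touch (arc_lPend (by omega))) ha
  · obtain rfl : k = m + 1 := by omega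
    -- No earlier comparison transfers here. In the wrong order, the vertices at distance two on
    -- either side leave no slack, so the two pendant intervals share an end point; their edges to
    -- the spine make both closed there.
    refine (UnitModel.not_touch (h.not_touch ha)).resolve_left fun hP => ?_
    have h1 := (h.lSpine_prec_lPend hlt (le_refl (m + 2)) (by omega) (by omega) (by omega)).le
    obtain ⟨t, ht1, ht2⟩ : ∃ t, M.Touch t (lSpine m) ∧ M.Prec (lPend (m + 1)) t := by
      rcases m with _ | m
      · exact ⟨y, h.touch arc_y_lSpine, (h.lPend_prec hlt 1 hk).2 rfl⟩
      · exact ⟨lSpine m, h.touch (arc_lSpine (by omega)),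
          h.lPend_prec_lSpine hlt (le_refl (m + 2)) hk (by omega)⟩
    have h2 := ht2.le
    have h3 := ht1.symm.le
    have h4 := (h.touch (arc_lPend (show m ≤ i by omega))).symm.le
    have h5 := (h.touch (arc_lPend hk)).le
    have h6 := (h.touch (arc_lSpine (show m + 1 ≤ i + 1 by omega))).symm.le
    have h7 := hP.le
    have e1 : M.a (lPend (m + 1)) = M.a (lPend m) + 1 := by linarith
    have e2 : M.a (lPend (m + 1)) = M.a (lSpine (m + 1)) + 1 := by linarith
    have e3 : M.a (lSpine m) = M.a (lPend m) + 1 := by linarith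
    exact h7.2 e1 ⟨(h4.2 e3).1, (h5.2 e2).2⟩

theorem z₂_prec_lSpine (h : M.Represents (KPrime i j))
    (hlt : M.a (lSpine 0) < M.a (rSpine 0)) {m : ℕ} (hm : m < i) (hp : m % 2 ≠ i % 2) :
    M.Prec z₂ (lSpine m) := by
  have ha : Apart (z₂ : KPrimeVertex i j) (lSpine m) := apart_z₂_lSpine (by omega) hp
  rcases m with _ | m
  · exact h.move ((h.lPend_prec hlt i le_rfl).2 (by omega)) (h.touch arc_lPend_z₂)
      (h.touch arc_y_lSpine) ha
  · exact h.move (h.lPend_prec_lSpine hlt (show m + 2 ≤ i by omega) le_rfl (by omega))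
      (h.touch arc_lPend_z₂) (h.touch (arc_lSpine (by omega))) ha

theorem z₂_prec_lPend (h : M.Represents (KPrime i j))
    (hlt : M.a (lSpine 0) < M.a (rSpine 0)) {m : ℕ} (hm : m < i) (hp : m % 2 = i % 2) :
    M.Prec z₂ (lPend m) :=
  h.move (h.lPend_prec_lSpine hlt (show m + 2 ≤ i by omega) le_rfl hp.symm)
    (h.touch arc_lPend_z₂) (h.touch (arc_lPend hm.le)) (apart_z₂_lPend hm hp)

/-- The order of z' and w' is tied to that of w and z'', which depends on the labelling. -/
theorem lSpine_prec_lPend_last (h : M.Represents (KPrime i j))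
    (hz : M.Prec (lSpine (i + 1)) z₂) : M.Prec (lSpine (i + 2)) (lPend i) :=
  h.move' hz (h.touch (arc_lSpine le_rfl)) (h.touch arc_lPend_z₂).symm
    (apart_lPend_lSpine le_rfl le_rfl (by omega) (by omega))

end UnitModel.Represents

/-! ### The explicit model and its symmetry -/

namespace KPrimeVertex

variable {i j : ℕ}

/-- Twice the left end point of the explicit intervals. -/
def pos : KPrimeVertex i j → ℤ
  | x₀ => 0
  | y₀ => -1
  | y => -2
  | right k => 2 * (k : ℕ)
  | rightPend k => 2 * (k : ℕ) + 2
  | left k => -2 * (k : ℕ) - 3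
  | leftPend k => -2 * (k : ℕ) - 3
  | w₁ => -2 * i - 5
  | z₁ => -2 * i - 7
  | w₂ => -2 * i - 3
  | z₂ => -2 * i - 3
  | v₁ => 2 * j + 2
  | v₂ => 2 * j + 2

/-- Whether an explicit interval contains its left end point. -/
def LeftClosed : KPrimeVertex i j → Prop
  | x₀ | leftPend _ | w₂ | z₂ => False
  | _ => True

/-- Whether an explicit interval contains its right end point. -/
def RightClosed (c₁ c₂ : Bool) : KPrimeVertex i j → Prop
  | x₀ | rightPend _ | w₂ | z₂ => False
  | v₁ => c₁
  | v₂ => c₂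
  | _ => True

/-- The explicit intervals as a model. -/
noncomputable def model (c₁ c₂ : Bool) : UnitModel (KPrimeVertex i j) where
  a u := (pos u : ℝ) / 2
  lc := LeftClosed
  rc := RightClosed c₁ c₂

theorem model_toFun (c₁ c₂ : Bool) :
    (model c₁ c₂ : UnitModel (KPrimeVertex i j)).toFun = interval c₁ c₂ := by
  funext u
  apply UnitModel.toFun_eq_of
  rcases u with _ | _ | _ | ⟨k, hk⟩ | ⟨k, hk⟩ | ⟨k, hk⟩ | ⟨k, hk⟩ | _ | _ | _ | _ | _ | _
  case x₀ => right; left; simp [model, interval, pos, LeftClosed, RightClosed]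
  case y₀ => left; norm_num [model, interval, pos, LeftClosed, RightClosed]
  case y => left; norm_num [model, interval, pos, LeftClosed, RightClosed]
  case right =>
    left
    simp only [model, interval, pos, LeftClosed, RightClosed, and_true]
    congr 1 <;> push_cast <;> ring
  case rightPend =>
    right; right; left
    simp only [model, interval, pos, LeftClosed, RightClosed, and_true, not_false_eq_true]
    congr 1 <;> push_cast <;> ring
  case left =>
    left
    simp only [model, interval, pos, LeftClosed, RightClosed, and_true]
    congr 1 <;> push_cast <;> ring
  case leftPend =>
    right; right; right
    simp only [model, interval, pos, LeftClosed, RightClosed, and_true, not_false_eq_true]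
    congr 1 <;> push_cast <;> ring
  case w₁ =>
    left
    simp only [model, interval, pos, LeftClosed, RightClosed, and_true]
    congr 1 <;> push_cast <;> ring
  case z₁ =>
    left
    simp only [model, interval, pos, LeftClosed, RightClosed, and_true]
    congr 1 <;> push_cast <;> ring
  case w₂ =>
    right; left
    simp only [model, interval, pos, LeftClosed, RightClosed, and_true, not_false_eq_true]
    congr 1 <;> push_cast <;> ring
  case z₂ =>
    right; left
    simp only [model, interval, pos, LeftClosed, RightClosed, and_true, not_false_eq_true]
    congr 1 <;> push_cast <;> ring
  case v₁ =>
    cases c₁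
    · right; right; left
      simp [model, interval, pos, LeftClosed, RightClosed]
      congr 1 <;> ring
    · left
      simp [model, interval, pos, LeftClosed, RightClosed]
      congr 1 <;> ring
  case v₂ =>
    cases c₂
    · right; right; left
      simp [model, interval, pos, LeftClosed, RightClosed]
      congr 1 <;> ring
    · left
      simp [model, interval, pos, LeftClosed, RightClosed]
      congr 1 <;> ring

theorem model_prec {c₁ c₂ : Bool} {u v : KPrimeVertex i j} :
    (model c₁ c₂).Prec u v ↔
      pos u + 2 < pos v ∨ (pos u + 2 = pos v ∧ ¬ (RightClosed c₁ c₂ u ∧ LeftClosed v)) := by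
  have h1 : (pos u : ℝ) / 2 + 1 < pos v / 2 ↔ pos u + 2 < pos v := by
    rw [← Int.cast_lt (R := ℝ)]
    push_cast
    constructor <;> intro <;> linarith
  have h2 : (pos u : ℝ) / 2 + 1 = pos v / 2 ↔ pos u + 2 = pos v := by
    rw [← Int.cast_inj (α := ℝ)]
    push_cast
    constructor <;> intro <;> linarith
  simp only [UnitModel.Prec, model, h1, h2]

theorem model_represents (c₁ c₂ : Bool) (hi : 1 ≤ i) (hj : 1 ≤ j) :
    (model c₁ c₂).Represents (KPrime i j) := by
  intro u v huv
  change side u ≠ side v at huv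
  rw [KPrime_adj, UnitModel.Touch, model_prec, model_prec]
  -- With doubled, hence integral, positions every pair of vertices becomes a question for `omega`.
  rcases u with _ | _ | _ | ⟨k, hk⟩ | ⟨k, hk⟩ | ⟨k, hk⟩ | ⟨k, hk⟩ | _ | _ | _ | _ | _ | _ <;>
  rcases v with _ | _ | _ | ⟨m, hm⟩ | ⟨m, hm⟩ | ⟨m, hm⟩ | ⟨m, hm⟩ | _ | _ | _ | _ | _ | _ <;>
  simp [side, Nat.bodd_eq_decide] at huv <;>
  simp [Arc, pos, LeftClosed, RightClosed] <;> omega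

end KPrimeVertex

namespace KPrimeVertex

variable {i j : ℕ}

theorem pos_rSpine {k : ℕ} (hk : k ≤ j + 1) : pos (rSpine k : KPrimeVertex i j) = 2 * k := by
  unfold rSpine
  split_ifs <;> (simp only [pos]; try omega)

theorem pos_rPend {k : ℕ} (hk : k ≤ j) : pos (rPend k : KPrimeVertex i j) = 2 * k + 2 := by
  unfold rPend
  split_ifs <;> (simp only [pos]; try omega)

theorem pos_lSpine {k : ℕ} (hk : k ≤ i + 2) :
    pos (lSpine k : KPrimeVertex i j) = -2 * k - 3 := by
  unfold lSpine
  split_ifs <;> (simp only [pos]; try omega)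

theorem pos_lPend {k : ℕ} (hk : k ≤ i) : pos (lPend k : KPrimeVertex i j) = -2 * k - 3 := by
  unfold lPend
  split_ifs <;> (simp only [pos]; try omega)

theorem pos_y₀ : pos (y₀ : KPrimeVertex i j) = -1 := rfl

theorem closed_lSpine (c₁ c₂ : Bool) (k m : ℕ) :
    RightClosed c₁ c₂ (lSpine k : KPrimeVertex i j) ∧ LeftClosed (lSpine m : KPrimeVertex i j) := by
  unfold lSpine
  split_ifs <;> exact ⟨trivial, trivial⟩

theorem model_prec_lSpine_iff {c₁ c₂ : Bool} {k m : ℕ} (hk : k ≤ i + 2) (hm : m ≤ i + 2) :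
    (model c₁ c₂ : UnitModel (KPrimeVertex i j)).Prec (lSpine k) (lSpine m) ↔ m + 2 ≤ k := by
  rw [model_prec, pos_lSpine hk, pos_lSpine hm]
  have := closed_lSpine (i := i) (j := j) c₁ c₂ k m
  simp only [this, and_self, not_true_eq_false, and_false, or_false]
  omega

theorem pos_le_of_prec {c₁ c₂ : Bool} {u v : KPrimeVertex i j} (h : (model c₁ c₂).Prec u v) :
    pos u + 2 ≤ pos v := by
  rw [model_prec] at h
  omega

/-- The automorphism of `K'` that exchanges `w`, `z'` with `w'`, `z''`. -/
def swap : KPrimeVertex i j → KPrimeVertex i j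
  | w₁ => w₂
  | w₂ => w₁
  | z₁ => z₂
  | z₂ => z₁
  | u => u

theorem swap_swap (u : KPrimeVertex i j) : swap (swap u) = u := by cases u <;> rfl

theorem side_swap (u : KPrimeVertex i j) : side (swap u) = side u := by cases u <;> rfl

theorem arc_swap (u v : KPrimeVertex i j) : Arc (swap u) (swap v) ↔ Arc u v := by
  cases u <;> cases v <;> rfl

/-- `swap` as an automorphism. -/
def swapIso : (KPrime i j).graph ≃g (KPrime i j).graph where
  toFun := swap
  invFun := swap
  left_inv := swap_swap
  right_inv := swap_swap
  map_rel_iff' := by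
    intro u v
    simp only [KPrime_adj, Equiv.coe_fn_mk, arc_swap]

end KPrimeVertex

/-! ### Uniqueness for K' -/

namespace UnitModel.Represents

open KPrimeVertex

variable {i j : ℕ} {M : UnitModel (KPrimeVertex i j)}

/-- In a representation that is oriented and labelled as the explicit one, all non-adjacent pairs
are ordered as in the explicit one. -/
theorem prec_of_model_prec (h : M.Represents (KPrime i j)) (hi : 1 ≤ i) (hj : 1 ≤ j)
    (hle : M.a (lSpine 0) ≤ M.a (rSpine 0)) (hz : M.Prec (lSpine (i + 1)) z₂)
    {c₁ c₂ : Bool} {u v : KPrimeVertex i j} (hs : side u ≠ side v) (hP : (model c₁ c₂).Prec u v) :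
    M.Prec u v := by
  have hcyc := h.cycle hi hj
  have hlt := hcyc.lt hle
  obtain ⟨hx, hy, hr, hd⟩ := h.rigid hi hj hle
  have hR := h.rArm.ends hr hd
  have hapart : ¬ M.Touch u v := by
    rw [← h u v hs, model_represents c₁ c₂ hi hj u v hs]
    exact fun ht => ht.1 hP
  have hpos := pos_le_of_prec hP
  -- The intervals are disjoint, so it is enough to exclude the reverse order.
  suffices hw : M.a u < M.a v + 1 ∨ M.Prec u v by
    rcases hw with hw | hw
    · refine (UnitModel.not_touch hapart).resolve_right fun hq => ?_
      linarith [hq.le.1]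
    · exact hw
  -- The place of y₀ is not determined, but at either extreme x₀ would be closed on that side and
  -- would meet y or r₁.
  have hy₀ : M.a (rSpine 0) - 1 < M.a y₀ ∧ M.a y₀ < M.a (rSpine 0) + 1 := by
    have h1 := hcyc.xy.le
    have h2 := hcyc.xy.symm.le
    have h3 := hcyc.yr.le
    have h4 := hcyc.hr₁.le
    have h5 := UnitModel.not_touch hcyc.nxy
    have h6 := UnitModel.not_touch hcyc.nxr₁
    constructor
    · refine lt_of_le_of_ne (by linarith) fun e => ?_
      rcases h5 with h5 | h5
      · linarith [h5.le.1]
      · exact h5.le.2 (by linarith) ⟨(h3.2 hy.symm).1, (h2.2 (by linarith)).2⟩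
    · refine lt_of_le_of_ne (by linarith) fun e => ?_
      rcases h6 with h6 | h6
      · exact h6.le.2 (by linarith) ⟨(h1.2 (by linarith)).1, (h4.2 hr).2⟩
      · linarith [h6.le.1]
  -- Crude bounds suffice for comparing the left arm with the rest; the sharper one serves the
  -- comparison with y₀, whose neighbour l₀ is exempt.
  have hleft : ∀ w : KPrimeVertex i j, ((∃ k ≤ i + 2, w = lSpine k) ∨ (∃ k ≤ i, w = lPend k) ∨
      w = z₂) → M.a w < M.a (rSpine 0) ∧
      (w ≠ lSpine 0 → side w = false → M.a w ≤ M.a (rSpine 0) - 2) := by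
    rintro w (⟨k, hk, rfl⟩ | ⟨k, hk, rfl⟩ | rfl)
    · rcases Nat.eq_zero_or_pos k with rfl | hk0
      · exact ⟨hlt, fun hne => absurd rfl hne⟩
      · obtain ⟨h1, h2⟩ := h.lSpine_prec hlt k hk0 hk
        rw [side_lSpine hk]
        rcases Nat.mod_two_eq_zero_or_one k with hm | hm
        · have := (h2 hm).le.1
          exact ⟨by linarith, fun _ _ => by linarith⟩
        · have := (h1 hm).le.1
          exact ⟨by linarith, fun _ => by simp [hm]⟩
    · obtain ⟨h1, h2⟩ := h.lPend_prec hlt k hk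
      rw [side_lPend hk]
      rcases Nat.mod_two_eq_zero_or_one k with hm | hm
      · have := (h1 hm).le.1
        exact ⟨by linarith, fun _ => by simp [hm]⟩
      · have := (h2 hm).le.1
        exact ⟨by linarith, fun _ _ => by linarith⟩
    · obtain ⟨h1, h2⟩ := h.z₂_prec hlt
      rw [side_z₂]
      rcases Nat.mod_two_eq_zero_or_one i with hm | hm
      · have := (h2 hm).le.1
        exact ⟨by linarith, fun _ _ => by linarith⟩
      · have := (h1 hm).le.1
        exact ⟨by linarith, fun _ => by simp [hm]⟩
  have hexact : ∀ w : KPrimeVertex i j, (w = x₀ ∨ w = y ∨ (∃ k ≤ j + 1, w = rSpine k) ∨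
      (∃ k ≤ j, w = rPend k)) → M.a w = M.a (rSpine 0) + (pos w : ℝ) / 2 ∧ -2 ≤ pos w := by
    rintro w (rfl | rfl | ⟨k, hk, rfl⟩ | ⟨k, hk, rfl⟩)
    · simp [pos, hx]
    · exact ⟨by simp only [pos]; push_cast; linarith, by simp [pos]⟩
    · rw [pos_rSpine hk]
      refine ⟨?_, by omega⟩
      rcases k with _ | k
      · simp
      · rw [(hR k (by omega)).2.1]
        push_cast
        ring
    · rw [pos_rPend hk, (hR k hk).2.2]
      refine ⟨?_, by omega⟩
      push_cast
      ring
  have classes : ∀ w : KPrimeVertex i j, (w = x₀ ∨ w = y ∨ (∃ k ≤ j + 1, w = rSpine k) ∨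
      (∃ k ≤ j, w = rPend k)) ∨ w = y₀ ∨ ((∃ k ≤ i + 2, w = lSpine k) ∨ (∃ k ≤ i, w = lPend k) ∨
      w = z₂) := by
    intro w
    rcases exists_position w with h | h | h | h | h | h | h | h
    · exact .inl (.inl h)
    · exact .inr (.inl h)
    · exact .inl (.inr (.inl h))
    · exact .inl (.inr (.inr (.inl h)))
    · exact .inl (.inr (.inr (.inr h)))
    · exact .inr (.inr (.inl h))
    · exact .inr (.inr (.inr (.inl h)))
    · exact .inr (.inr (.inr (.inr h)))
  have hposl : ∀ w : KPrimeVertex i j, ((∃ k ≤ i + 2, w = lSpine k) ∨ (∃ k ≤ i, w = lPend k) ∨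
      w = z₂) → pos w ≤ -3 := by
    rintro w (⟨k, hk, rfl⟩ | ⟨k, hk, rfl⟩ | rfl)
    · rw [pos_lSpine hk]
      omega
    · rw [pos_lPend hk]
      omega
    · simp only [pos]
      omega
  rcases classes u with hu | rfl | hu <;> rcases classes v with hv | rfl | hv
  · left
    obtain ⟨hu, -⟩ := hexact u hu
    obtain ⟨hv, -⟩ := hexact v hv
    have : (pos u : ℝ) + 2 ≤ pos v := by exact_mod_cast hpos
    linarith
  · have := (hexact u hu).2
    rw [pos_y₀] at hpos
    omega
  · have := (hexact u hu).2
    have := hposl v hv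
    omega
  · left
    obtain ⟨hv, -⟩ := hexact v hv
    have : (pos (y₀ : KPrimeVertex i j) : ℝ) + 2 ≤ pos v := by exact_mod_cast hpos
    rw [pos_y₀] at this
    push_cast at this
    linarith [hy₀.2]
  · exact absurd rfl hs
  · have := hposl v hv
    rw [pos_y₀] at hpos
    omega
  · left
    obtain ⟨hv, hv'⟩ := hexact v hv
    have : (-2 : ℝ) ≤ pos v := by exact_mod_cast hv'
    linarith [(hleft u hu).1]
  · left
    have hne : u ≠ lSpine 0 := by
      rintro rfl
      exact hapart hcyc.yl₀.symm
    have hsu : side u = false := by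
      cases hc : side u
      · rfl
      · exact absurd hc hs
    linarith [(hleft u hu).2 hne hsu, hy₀.1]
  · right
    clear hleft hexact classes hposl
    rcases hu with ⟨k, hk, rfl⟩ | ⟨k, hk, rfl⟩ | rfl <;>
      rcases hv with ⟨m, hm, rfl⟩ | ⟨m, hm, rfl⟩ | rfl
    · rw [model_prec_lSpine_iff hk hm] at hP
      rw [side_lSpine hk, side_lSpine hm] at hs
      simp only [ne_eq, decide_eq_decide] at hs
      exact h.lSpine_prec_lSpine hlt m k (by omega) hk (by omega)
    · rw [pos_lSpine hk, pos_lPend hm] at hpos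
      rw [side_lSpine hk, side_lPend hm] at hs
      simp only [ne_eq, Bool.eq_not, decide_eq_decide, not_not] at hs
      by_cases hmi : m < i
      · exact h.lSpine_prec_lPend hlt (by omega) hk hmi (by omega)
      -- This is the pair z', w', whose order rests on the labelling hypothesis `hz`.
      · obtain rfl : m = i := by omega
        obtain rfl : k = m + 2 := by omega
        exact h.lSpine_prec_lPend_last hz
    · rw [pos_lSpine hk] at hpos
      rw [side_lSpine hk, side_z₂] at hs
      simp only [pos, ne_eq, decide_eq_decide] at hs hpos
      obtain rfl : k = i + 1 := by omega
      exact hz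
    · rw [pos_lPend hk, pos_lSpine hm] at hpos
      rw [side_lPend hk, side_lSpine hm] at hs
      simp only [ne_eq, Bool.not_eq_eq_eq_not] at hs
      exact h.lPend_prec_lSpine hlt (by grind) hk (by grind)
    · rw [pos_lPend hk, pos_lPend hm] at hpos
      rw [side_lPend hk, side_lPend hm] at hs
      simp only [ne_eq, Bool.not_eq_eq_eq_not, Bool.not_not, decide_eq_decide] at hs
      exact h.lPend_prec_lPend hlt (by omega) hk (by omega)
    · rw [pos_lPend hk] at hpos
      simp only [pos] at hpos
      omega
    · rw [pos_lSpine hm] at hpos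
      rw [side_lSpine hm, side_z₂] at hs
      simp only [pos, ne_eq, decide_eq_decide] at hs hpos
      exact h.z₂_prec_lSpine hlt (by omega) (by omega)
    · rw [pos_lPend hm] at hpos
      rw [side_lPend hm, side_z₂] at hs
      simp only [pos] at hpos
      exact h.z₂_prec_lPend hlt (by omega) (by grind)
    · exact absurd rfl hs

theorem trivialModification_of_labelled (h : M.Represents (KPrime i j)) (hi : 1 ≤ i) (hj : 1 ≤ j)
    (hle : M.a (lSpine 0) ≤ M.a (rSpine 0)) (hz : M.Prec (lSpine (i + 1)) z₂) (c₁ c₂ : Bool) :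
    (KPrime i j).TrivialModification (interval c₁ c₂) M.toFun := by
  rw [← model_toFun]
  refine trivialModification_of_prec_iff (model_represents c₁ c₂ hi hj) h fun u v hs => ?_
  refine ⟨h.prec_of_model_prec hi hj hle hz hs, fun hP => ?_⟩
  have hn : ¬ (model c₁ c₂).Touch u v := by
    rw [← model_represents c₁ c₂ hi hj u v hs, h u v hs]
    exact fun ht => ht.1 hP
  -- The explicit model also orders this pair, and the wrong order would carry over to `M`.
  exact (UnitModel.not_touch hn).resolve_right fun hq =>
    hP.not_prec (h.prec_of_model_prec hi hj hle hz hs.symm hq)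

theorem trivialModification_of_oriented (h : M.Represents (KPrime i j)) (hi : 1 ≤ i) (hj : 1 ≤ j)
    (hle : M.a (lSpine 0) ≤ M.a (rSpine 0)) (c₁ c₂ : Bool) :
    (KPrime i j).TrivialModification (interval c₁ c₂) M.toFun := by
  have e1 : (lSpine (i + 1) : KPrimeVertex i j) = w₁ := by simp [lSpine]
  rcases UnitModel.not_touch (h.not_touch (apart_z₂_lSpine (k := i + 1) (by omega) (by omega)))
    with hz | hz
  -- If z'' is left of w, then w' is left of z', which is the required order after exchanging the
  -- branches.
  · have hz' : M.Prec w₂ z₁ := by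
      have e2 : (lSpine (i + 2) : KPrimeVertex i j) = z₁ := by simp [lSpine]
      have e3 : (lPend i : KPrimeVertex i j) = w₂ := by simp [lPend]
      rw [← e2, ← e3]
      exact h.move hz (h.touch arc_lPend_z₂).symm (h.touch (arc_lSpine le_rfl))
        (apart_lPend_lSpine le_rfl le_rfl (by omega) (by omega))
    let N : UnitModel (KPrimeVertex i j) :=
      ⟨fun u => M.a (swap u), fun u => M.lc (swap u), fun u => M.rc (swap u)⟩
    have hN : N.Represents (KPrime i j) := by
      intro u v huv
      have := h (swap u) (swap v) (by
        change side (swap u) ≠ side (swap v)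
        rwa [side_swap, side_swap])
      rw [KPrime_adj, arc_swap, arc_swap] at this
      rw [KPrime_adj, this]
      rfl
    have hNM : M.toFun = fun u => N.toFun (swapIso u) := by
      funext u
      have e : swap (swapIso u) = u := swap_swap u
      simp only [toFun, N, e]
    rw [hNM]
    refine (hN.trivialModification_of_labelled hi hj ?_ ?_ c₁ c₂).tail (.relabel _ swapIso)
    · have e2 : swap (lSpine 0 : KPrimeVertex i j) = lSpine 0 := by simp [lSpine, swap]
      have e3 : swap (rSpine 0 : KPrimeVertex i j) = rSpine 0 := by simp [rSpine, swap]
      simpa only [N, e2, e3] using hle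
    · rw [e1]
      exact hz'
  · exact h.trivialModification_of_labelled hi hj hle hz c₁ c₂

theorem trivialModification (h : M.Represents (KPrime i j)) (hi : 1 ≤ i) (hj : 1 ≤ j)
    (c₁ c₂ : Bool) : (KPrime i j).TrivialModification (interval c₁ c₂) M.toFun := by
  rcases le_total (M.a (lSpine 0)) (M.a (rSpine 0)) with hle | hle
  · exact h.trivialModification_of_oriented hi hj hle c₁ c₂
  · have hr := h.reflect.trivialModification_of_oriented hi hj
      (by simpa only [UnitModel.reflect, sub_le_sub_iff_right, neg_le_neg_iff] using hle) c₁ c₂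
    have e : M.toFun = fun v => (fun x => 2 * 0 - x) '' M.reflect.toFun v := by
      funext v
      rw [← reflect_toFun, reflect_reflect]
    rw [e]
    exact hr.tail (.reflect _ 0)

end UnitModel.Represents

/-! ### Non-representability of K -/

open KPrimeVertex in
theorem KBigraph_adj_base {i j : ℕ} {u v : KPrimeVertex i j} :
    (KBigraph i j).graph.Adj (.base u) (.base v) ↔ (KPrime i j).graph.Adj u v := by
  rw [KPrime_adj]
  refine ⟨fun h => h.2, fun h => ⟨?_, h⟩⟩
  intro e
  obtain rfl := KVertex.base.inj e
  rcases h with h | h <;> exact side_ne_of_arc _ _ h rfl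

namespace KBigraph

open KPrimeVertex UnitModel

variable {i j : ℕ} {M : UnitModel (KVertex i j)}

theorem base_represents (h : M.Represents (KBigraph i j)) :
    (⟨fun u => M.a (.base u), fun u => M.lc (.base u), fun u => M.rc (.base u)⟩ :
      UnitModel (KPrimeVertex i j)).Represents (KPrime i j) := fun u v huv => by
  rw [← KBigraph_adj_base]
  exact h (.base u) (.base v) huv

/-- In this orientation the right arm is rigid, although its last two vertices v' and v'' now have
private neighbours. -/
theorem not_oriented (h : M.Represents (KBigraph i j)) (hi : 1 ≤ i) (hj : 1 ≤ j) :
    ¬ M.a (.base (lSpine 0)) ≤ M.a (.base (rSpine 0)) := by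
  intro hle
  have hb := base_represents h
  have hr := (hb.rigid hi hj hle).2.2
  have e1 : (rSpine (j + 1) : KPrimeVertex i j) = v₁ := by simp [rSpine]
  have e2 : (rPend j : KPrimeVertex i j) = v₂ := by simp [rPend]
  have h1 : M.Touch (.base (rSpine (j + 1))) .t₁ := by
    rw [e1, ← h _ _ (by simp [KBigraph, KVertex.side, side])]
    exact ⟨by simp, Or.inl trivial⟩
  have h2 : M.Touch (.base (rPend j)) .t₂ := by
    rw [e2, ← h _ _ (by simp [KBigraph, KVertex.side, side])]
    exact ⟨by simp, Or.inl trivial⟩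
  have h3 : ¬ M.Touch (.base (rPend j)) .t₁ := by
    rw [e2, ← h _ _ (by simp [KBigraph, KVertex.side, side])]
    rintro ⟨-, h | h⟩ <;> exact h
  have h4 : ¬ M.Touch (.base (rSpine (j + 1))) .t₂ := by
    rw [e1, ← h _ _ (by simp [KBigraph, KVertex.side, side])]
    rintro ⟨-, h | h⟩ <;> exact h
  have hA : M.Arm j (fun k => .base (rSpine k)) (fun k => .base (rPend k)) :=
    ⟨hb.rArm.spine, hb.rArm.pend, hb.rArm.not_spine, hb.rArm.not_pend⟩
  exact hA.not_private h1 h2 h3 h4 hr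

theorem not_represents (hi : 1 ≤ i) (hj : 1 ≤ j) : ¬ M.Represents (KBigraph i j) := by
  intro h
  rcases le_total (M.a (.base (lSpine 0))) (M.a (.base (rSpine 0))) with hle | hle
  · exact not_oriented h hi hj hle
  · refine not_oriented h.reflect hi hj ?_
    simpa only [UnitModel.reflect, sub_le_sub_iff_right, neg_le_neg_iff] using hle

/-- `K` is connected: a property that passes along edges holds at every vertex or at none. -/
theorem forall_of_adj_iff (P : KVertex i j → Prop) (h0 : P (.base x₀))
    (hP : ∀ u v, (KBigraph i j).graph.Adj u v → (P u ↔ P v)) (u : KVertex i j) : P u := by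
  have hb : ∀ u v : KPrimeVertex i j, Arc u v → (P (.base u) ↔ P (.base v)) := fun u v h =>
    hP _ _ (KBigraph_adj_base.2 (KPrime_adj.2 (Or.inl h)))
  have hy₀ : P (.base y₀) := (hb x₀ y₀ trivial).1 h0
  have hR : ∀ k ≤ j + 1, P (.base (rSpine k)) := by
    intro k
    induction k with
    | zero => exact fun _ => (hb _ _ arc_y₀_rSpine).1 hy₀
    | succ k ih => exact fun hk => (hb _ _ (arc_rSpine (by omega))).1 (ih (by omega))
  have hL : ∀ k ≤ i + 2, P (.base (lSpine k)) := by
    intro k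
    induction k with
    | zero => exact fun _ => (hb _ _ arc_y₀_lSpine).1 hy₀
    | succ k ih => exact fun hk => (hb _ _ (arc_lSpine (by omega))).1 (ih (by omega))
  have hR' : ∀ k ≤ j, P (.base (rPend k)) := fun k hk =>
    (hb _ _ (arc_rPend hk)).1 (hR k (by omega))
  have hL' : ∀ k ≤ i, P (.base (lPend k)) := fun k hk =>
    (hb _ _ (arc_lPend hk)).1 (hL k (by omega))
  have hB : ∀ u : KPrimeVertex i j, P (.base u) := by
    intro u
    rcases exists_position u with rfl | rfl | rfl | ⟨k, hk, rfl⟩ | ⟨k, hk, rfl⟩ | ⟨k, hk, rfl⟩ |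
      ⟨k, hk, rfl⟩ | rfl
    · exact h0
    · exact hy₀
    · exact (hb _ _ arc_y_rSpine).2 (hR 0 (by omega))
    · exact hR k hk
    · exact hR' k hk
    · exact hL k hk
    · exact hL' k hk
    · exact (hb _ _ arc_lPend_z₂).1 (hL' i le_rfl)
  rcases u with u | _ | _
  · exact hB u
  · exact (hP (.base v₁) .t₁ ⟨by simp, Or.inl trivial⟩).1 (hB v₁)
  · exact (hP (.base v₂) .t₂ ⟨by simp, Or.inl trivial⟩).1 (hB v₂)

/-- An embedding of `K` into a bigraph respects the partite sets, up to exchanging them. -/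
theorem side_ne_iff {V : Type*} (B : Bigraph V) (φ : (KBigraph i j).graph ↪g B.graph)
    (u v : KVertex i j) :
    (KBigraph i j).side u ≠ (KBigraph i j).side v ↔ B.side (φ u) ≠ B.side (φ v) := by
  -- Whether `φ` exchanges the partite sets is the same at both ends of every edge, hence
  -- everywhere.
  have key := forall_of_adj_iff (i := i) (j := j)
    (fun u => xor (B.side (φ u)) ((KBigraph i j).side u) =
      xor (B.side (φ (.base x₀))) ((KBigraph i j).side (.base x₀))) rfl (fun u v huv => by
        have h1 := (KBigraph i j).side_ne_of_adj huv
        have h2 := B.side_ne_of_adj (φ.map_rel_iff.2 huv)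
        revert h1 h2
        generalize (KBigraph i j).side u = a
        generalize (KBigraph i j).side v = b
        generalize B.side (φ u) = c
        generalize B.side (φ v) = d
        revert a b c d
        simp)
  have h := (key u).trans (key v).symm
  revert h
  generalize (KBigraph i j).side u = a
  generalize (KBigraph i j).side v = b
  generalize B.side (φ u) = c
  generalize B.side (φ v) = d
  revert a b c d
  decide

end KBigraph

theorem lemma4 (i j : ℕ) (hi : 1 ≤ i) (hj : 1 ≤ j) :
    (∀ c₁ c₂ : Bool,
      (KPrime i j).IsUnitRep (KPrimeVertex.interval c₁ c₂) ∧
      ∀ f : KPrimeVertex i j → Set ℝ, (KPrime i j).IsUnitRep f →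
        (KPrime i j).TrivialModification (KPrimeVertex.interval c₁ c₂) f) ∧
    (∀ (V : Type*) (B : Bigraph V), B.IsMixedUnitInterval →
      ¬ (KBigraph i j).graph.IsIndContained B.graph) := by
  refine ⟨fun c₁ c₂ => ⟨?_, fun f hf => ?_⟩, ?_⟩
  · rw [← KPrimeVertex.model_toFun, UnitModel.isUnitRep_iff]
    exact KPrimeVertex.model_represents c₁ c₂ hi hj
  · obtain ⟨M, rfl⟩ := UnitModel.exists_model f hf.1
    exact (UnitModel.isUnitRep_iff.1 hf).trivialModification hi hj c₁ c₂
  · rintro V B ⟨f, hf⟩ ⟨φ⟩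
    obtain ⟨M, rfl⟩ := UnitModel.exists_model f hf.1
    rw [UnitModel.isUnitRep_iff] at hf
    -- The model is pulled back along `φ`. Induced containment ignores the bipartitions, so
    -- `side_ne_iff` is needed to match them.
    refine KBigraph.not_represents hi hj
      (M := ⟨fun u => M.a (φ u), fun u => M.lc (φ u), fun u => M.rc (φ u)⟩) fun u v huv => ?_
    rw [← φ.map_rel_iff]
    exact hf (φ u) (φ v) ((KBigraph.side_ne_iff B φ u v).1 huv)
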